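/- Let $\mathbb S=\{I\in\mathbb H: I^2=-1\}$, $\mathbb C_I=\{x+Iy : x,y\in\mathbb R\}$, and let $\Omega\subseteq\mathbb H$ be a circular domain, i.e. a nonempty connected open set such that $x+Iy\in\Omega$ with $x,y\in\mathbb R$, $I\in\mathbb S$ implies $x+Jy\in\Omega$ for all $J\in\mathbb S$. A function $f$ on a circular open set $U$ is slice regular if it is a slice function, $f(x+Iy)=F_1(x,y)+I\,F_2(x,y)$ with $F_1,F_2$ independent of $I\in\mathbb S$, and each restriction $f_I=f|_{U\cap\mathbb C_I}$ is real differentiable with $(\partial_x+I\partial_y)f_I=0$. Let $\mathcal{SEM}(\Omega)$ be the ring of slice semi-regular functions on $\Omega$ (slice regular on a circular open $U\subseteq\Omega$, every point of $\Omega\setminus U$ being a pole or a removable singularity; functions agreeing on a dense circular open subset of $\Omega$ are identified) with pointwise addition and the $*$-product, given by $(f*g)(q)=f(q)\,g(f(q)^{-1}qf(q))$ if $f(q)\neq 0$ and $(f*g)(q)=0$ if $f(q)=0$. Let $\mathcal{SEM}_{\mathbb R}(\Omega)\subseteq\mathcal{SEM}(\Omega)$ be the central subfield of slice preserving functions (those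 with $f(U\cap\mathbb C_I)\subseteq\mathbb C_I$ for all $I\in\mathbb S$). For $f\in\mathcal{SEM}(\Omega)$ let $f^c$ be its regular conjugate (if $f(x+Iy)=F_1+IF_2$ then $f^c(x+Iy)=\overline{F_1}+I\,\overline{F_2}$), $f_0=(f+f^c)/2$, $f_v=f-f_0$ and $f^s=f*f^c$; write $f_v^s=(f_v)^s$. For $f,g\in\mathcal{SEM}(\Omega)$ let $\mathcal S_{f,g}:\mathcal{SEM}(\Omega)\to\mathcal{SEM}(\Omega)$ be the $\mathcal{SEM}_{\mathbb R}(\Omega)$-linear Sylvester operator $\mathcal S_{f,g}(\chi)=f*\chi+\chi*g$. Theorem. Let $f,g\in\mathcal{SEM}(\Omega)\setminus\mathcal{SEM}_{\mathbb R}(\Omega)$ be such that $f_0=-g_0$ and $f_v^s=g_v^s$. Then $$\ker(\mathcal S_{f,g})=\{f*h+h*g^c : h\in\mathcal{SEM}(\Omega)\},$$ and this is a $2$-dimensional vector space over $\mathcal{SEM}_{\mathbb R}(\Omega)$. Moreover, $\ker(\mathcal S_{f,g})$ has a basis over $\mathcal{SEM}_{\mathbb R}(\Omega)$ consisting of $*$-invertible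 elements of $\mathcal{SEM}(\Omega)$. -/

import Mathlib

open scoped Quaternion

noncomputable section

namespace SliceRegular

/-! Quaternionic preliminaries -/

/-- The sphere of imaginary units `𝕊 = {I ∈ ℍ | I² = -1}`. -/
def ImUnits : Set ℍ := {I | I * I = -1}

/-- The point `x + I y` for `z = x + i y`; for fixed `I ∈ 𝕊`, this parametrizes the slice `ℂ_I`. -/
def pt (I : ℍ) (z : ℂ) : ℍ := (z.re : ℍ) + z.im • I

/-- The sphere `𝕊_p = {x + J y | J ∈ 𝕊}` of a point `p = x + I y`. -/
def sphere (p : ℍ) : Set ℍ :=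
  {q | ∃ z : ℂ, ∃ I ∈ ImUnits, ∃ J ∈ ImUnits, p = pt I z ∧ q = pt J z}

/-- A set is circular if with `x + I y` it contains the whole sphere `x + 𝕊 y`. -/
def IsCircular (U : Set ℍ) : Prop :=
  ∀ z : ℂ, ∀ I ∈ ImUnits, ∀ J ∈ ImUnits, pt I z ∈ U → pt J z ∈ U

/-- A circular domain: a nonempty connected open circular subset of `ℍ`. -/
structure CircularDomain where
  carrier : Set ℍ
  isOpen : IsOpen carrier
  isConnected : IsConnected carrier
  circular : IsCircular carrier

/-- The polynomial `Δ_p(q) = q² - q (p + pᶜ) + p pᶜ`, which vanishes exactly on `𝕊_p`. -/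
def sphPoly (p q : ℍ) : ℍ := q * q - q * (p + star p) + p * star p

/-- `f` is a slice function on `U`: `f (x + I y) = F₁(x,y) + I F₂(x,y)` with `F₁`, `F₂`
independent of `I ∈ 𝕊`. (Using both `x + I y` and `x + (-I)(-y)` forces `F₁` to be even
and `F₂` to be odd in `y`.) -/
def IsSlice (U : Set ℍ) (f : ℍ → ℍ) : Prop :=
  ∃ F₁ F₂ : ℂ → ℍ, ∀ I ∈ ImUnits, ∀ z, pt I z ∈ U → f (pt I z) = F₁ z + I * F₂ z

/-- `f` is slice regular on the (open, circular) set `U`: it is a slice function and each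
restriction `f_I` is real differentiable with `(∂/∂x + I ∂/∂y) f_I = 0`. Only the values of `f`
on `U` matter. -/
def IsSliceRegular (U : Set ℍ) (f : ℍ → ℍ) : Prop :=
  IsSlice U f ∧ ∀ I ∈ ImUnits, ∀ z, pt I z ∈ U →
    ∃ L : ℂ →L[ℝ] ℍ, HasFDerivAt (fun w => f (pt I w)) L z ∧ L 1 + I * L Complex.I = 0

/-- `p` is a pole or a removable singularity for `f`, which is regular on `U`: `𝕊_p` is an isolated
singularity, of finite spherical order, i.e. `Δ_p ^ n f` extends regularly across `𝕊_p` for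
some `n`. -/
def IsPoleOrRemovable (Ω U : Set ℍ) (f : ℍ → ℍ) (p : ℍ) : Prop :=
  ∃ n : ℕ, ∃ W : Set ℍ, IsOpen W ∧ IsCircular W ∧ p ∈ W ∧ W ⊆ Ω ∧ W \ sphere p ⊆ U ∧
    ∃ φ : ℍ → ℍ, IsSliceRegular W φ ∧ ∀ q ∈ W \ sphere p, sphPoly p q ^ n * f q = φ q

/-- `f` is slice regular on the circular open subset `U` of `Ω`, and each point of `Ω \ U` is a pole
or a removable singularity. -/
structure IsSemiRegularOn (Ω U : Set ℍ) (f : ℍ → ℍ) : Prop where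
  isOpen : IsOpen U
  circular : IsCircular U
  subset : U ⊆ Ω
  regular : IsSliceRegular U f
  pole : ∀ p ∈ Ω \ U, IsPoleOrRemovable Ω U f p

/-- `f` is slice semi-regular in `Ω`. The values of `f` at its singularities and outside `Ω` are
irrelevant. -/
def IsSemiRegular (Ω : CircularDomain) (f : ℍ → ℍ) : Prop :=
  ∃ U, IsSemiRegularOn Ω.carrier U f

/-- Two functions are identified if they agree on a circular open set that is dense in `Ω`. -/
def SemiEq (Ω : CircularDomain) (f g : ℍ → ℍ) : Prop :=
  ∃ V, IsOpen V ∧ IsCircular V ∧ V ⊆ Ω.carrier ∧ Ω.carrier ⊆ closure V ∧ Set.EqOn f g V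

/-- The `*`-product, by its pointwise formula. -/
def starMul (f g : ℍ → ℍ) (q : ℍ) : ℍ :=
  open Classical in if f q = 0 then 0 else f q * g ((f q)⁻¹ * q * f q)

/-- `𝒥(q) = q_v / |q_v|` (and `0` if `q` is real). -/
def imDir (q : ℍ) : ℍ := ‖q.im‖⁻¹ • q.im

/-- The regular conjugate `fᶜ`. If `f(x + I y) = F₁ + I F₂`, then
`F₁ = (f(q) + f(qᶜ))/2`, `𝒥(q) F₂ = (f(q) - f(qᶜ))/2`, and this is `fᶜ(x + I y) = F₁ᶜ + I F₂ᶜ`.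
Equivalently, if `f = f₀ + f₁ i + f₂ j + f₃ k` with slice preserving `f_ℓ`, then
`fᶜ = f₀ - f₁ i - f₂ j - f₃ k`; see `regConj_components`. -/
def regConj (f : ℍ → ℍ) (q : ℍ) : ℍ :=
  (2⁻¹ : ℝ) • (star (f q) + star (f (star q)) +
    imDir q * (star (f q) - star (f (star q))) * imDir q)

/-! Basic facts on imaginary units and slices -/

lemma coe_eq_smul_one (x : ℝ) : (x : ℍ) = x • (1 : ℍ) := by
  rw [← Quaternion.coe_mul_eq_smul, mul_one]

lemma neg_mem_imUnits {I : ℍ} (hI : I ∈ ImUnits) : -I ∈ ImUnits := by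
  have h : I * I = -1 := hI
  change -I * -I = -1
  rw [neg_mul_neg, h]

lemma imUnits_normSq {I : ℍ} (hI : I ∈ ImUnits) : Quaternion.normSq I = 1 := by
  have h : I * I = -1 := hI
  have h2 := congrArg Quaternion.normSq h
  rw [map_mul, Quaternion.normSq_neg, map_one] at h2
  have h3 := Quaternion.normSq_nonneg (a := I)
  nlinarith

lemma imUnits_re {I : ℍ} (hI : I ∈ ImUnits) : I.re = 0 := by
  rw [← Quaternion.sq_eq_neg_normSq, imUnits_normSq hI, sq]
  simpa using (show I * I = -1 from hI)

lemma imUnits_star {I : ℍ} (hI : I ∈ ImUnits) : star I = -I :=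
  Quaternion.star_eq_neg.2 (imUnits_re hI)

lemma conj_mem_imUnits {I a : ℍ} (hI : I ∈ ImUnits) (ha : a ≠ 0) : a⁻¹ * I * a ∈ ImUnits := by
  have h : I * I = -1 := hI
  change a⁻¹ * I * a * (a⁻¹ * I * a) = -1
  calc a⁻¹ * I * a * (a⁻¹ * I * a) = a⁻¹ * I * (a * a⁻¹) * I * a := by noncomm_ring
    _ = a⁻¹ * (I * I) * a := by rw [mul_inv_cancel₀ ha]; noncomm_ring
    _ = -1 := by rw [h]; simp [ha]

lemma conj_pt {I a : ℍ} (z : ℂ) (ha : a ≠ 0) : a⁻¹ * pt I z * a = pt (a⁻¹ * I * a) z := by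
  have h : a⁻¹ * (z.re : ℍ) * a = z.re := by
    rw [mul_assoc, Quaternion.coe_commutes, ← mul_assoc, inv_mul_cancel₀ ha, one_mul]
  simp [pt, mul_add, add_mul, h]

lemma star_pt {I : ℍ} (hI : I ∈ ImUnits) (z : ℂ) : star (pt I z) = pt (-I) z := by
  simp [pt, imUnits_star hI]

lemma exists_pt (q : ℍ) : ∃ I ∈ ImUnits, ∃ z : ℂ, q = pt I z := by
  by_cases h : q.im = 0
  · refine ⟨((Complex.I : ℂ) : ℍ), ?_, ⟨q.re, 0⟩, ?_⟩
    · change _ * _ = _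
      rw [← Quaternion.coeComplex_mul, Complex.I_mul_I]
      ext <;> simp
    · have := Quaternion.re_add_im q
      rw [h, add_zero] at this
      simp only [pt, zero_smul, add_zero, this]
  · have hn : ‖q.im‖ ≠ 0 := norm_ne_zero_iff.2 h
    refine ⟨‖q.im‖⁻¹ • q.im, ?_, ⟨q.re, ‖q.im‖⟩, ?_⟩
    · change _ * _ = _
      rw [smul_mul_smul_comm, ← sq q.im, Quaternion.im_sq, Quaternion.normSq_eq_norm_mul_self,
        smul_neg]
      congr 1
      rw [← Quaternion.coe_smul, smul_eq_mul]
      have : ‖q.im‖⁻¹ * ‖q.im‖⁻¹ * (‖q.im‖ * ‖q.im‖) = 1 := by field_simp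
      rw [this]; rfl
    · have := Quaternion.re_add_im q
      simp [pt, smul_smul, hn, this]

lemma IsCircular.conj_mem {U : Set ℍ} (hU : IsCircular U) {q a : ℍ} (hq : q ∈ U) (ha : a ≠ 0) :
    a⁻¹ * q * a ∈ U := by
  obtain ⟨I, hI, z, rfl⟩ := exists_pt q
  rw [conj_pt z ha]
  exact hU z I hI _ (conj_mem_imUnits hI ha) hq

lemma IsCircular.star_mem {U : Set ℍ} (hU : IsCircular U) {q : ℍ} (hq : q ∈ U) : star q ∈ U := by
  obtain ⟨I, hI, z, rfl⟩ := exists_pt q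
  rw [star_pt hI]
  exact hU z I hI _ (neg_mem_imUnits hI) hq

lemma IsCircular.inter {U V : Set ℍ} (hU : IsCircular U) (hV : IsCircular V) :
    IsCircular (U ∩ V) :=
  fun z I hI J hJ h => ⟨hU z I hI J hJ h.1, hV z I hI J hJ h.2⟩

lemma continuous_pt (I : ℍ) : Continuous (pt I) := by
  unfold pt
  exact (Quaternion.continuous_coe.comp Complex.continuous_re).add
    (Complex.continuous_im.smul continuous_const)

/-! The polynomial `Δ_p` -/

lemma sphPoly_eq (p q : ℍ) :
    sphPoly p q = q * q - (2 * p.re) • q + ((Quaternion.normSq p : ℝ) : ℍ) := by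
  rw [sphPoly, Quaternion.self_mul_star, Quaternion.self_add_star]
  congr 2
  rw [show (2 : ℍ) * (p.re : ℍ) = ((2 * p.re : ℝ) : ℍ) by push_cast; rfl,
    ← Quaternion.coe_commutes, Quaternion.coe_mul_eq_smul]

lemma re_pt {I : ℍ} (hI : I ∈ ImUnits) (z : ℂ) : (pt I z).re = z.re := by
  simp [pt, imUnits_re hI]

lemma im_pt {I : ℍ} (hI : I ∈ ImUnits) (z : ℂ) : (pt I z).im = z.im • I := by
  have h : I.im = I := by
    have := Quaternion.re_add_im I
    rwa [imUnits_re hI, Quaternion.coe_zero, zero_add] at this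
  simp [pt, h]

lemma normSq_pt {I : ℍ} (hI : I ∈ ImUnits) (z : ℂ) :
    Quaternion.normSq (pt I z) = z.re ^ 2 + z.im ^ 2 := by
  have h1 := imUnits_normSq hI
  have h0 := imUnits_re hI
  rw [Quaternion.normSq_def'] at h1 ⊢
  simp only [pt, Quaternion.re_add, Quaternion.imI_add, Quaternion.imJ_add, Quaternion.imK_add,
    Quaternion.re_coe, Quaternion.imI_coe, Quaternion.imJ_coe, Quaternion.imK_coe,
    Quaternion.re_smul, Quaternion.imI_smul, Quaternion.imJ_smul, Quaternion.imK_smul,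
    smul_eq_mul, h0] at h1 ⊢
  linear_combination z.im ^ 2 * h1

lemma sphPoly_eq_sq (z : ℂ) {I : ℍ} (hI : I ∈ ImUnits) (q : ℍ) :
    sphPoly (pt I z) q = (q - (z.re : ℍ)) * (q - (z.re : ℍ)) + ((z.im ^ 2 : ℝ) : ℍ) := by
  rw [sphPoly_eq, re_pt hI, normSq_pt hI, sub_mul, mul_sub, mul_sub, ← Quaternion.coe_commutes,
    ← Quaternion.coe_mul, Quaternion.coe_mul_eq_smul, two_mul, add_smul, Quaternion.coe_add,
    ← sq z.re]
  abel

lemma sphPoly_eq_zero_iff (p q : ℍ) : sphPoly p q = 0 ↔ q ∈ sphere p := by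
  constructor
  · intro h
    obtain ⟨I, hI, z, rfl⟩ := exists_pt p
    rw [sphPoly_eq_sq z hI] at h
    by_cases hy : z.im = 0
    · rw [hy] at h
      simp [sub_eq_zero] at h
      exact ⟨z, I, hI, I, hI, rfl, by simp [pt, hy, h]⟩
    · refine ⟨z, I, hI, z.im⁻¹ • (q - (z.re : ℍ)), ?_, rfl, ?_⟩
      · change _ * _ = _
        rw [smul_mul_smul_comm, eq_neg_of_add_eq_zero_left h, smul_neg, ← Quaternion.coe_smul,
          smul_eq_mul]
        have : z.im⁻¹ * z.im⁻¹ * z.im ^ 2 = 1 := by field_simp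
        rw [this]; rfl
      · simp [pt, smul_smul, hy]
  · rintro ⟨z, I, hI, J, hJ, rfl, rfl⟩
    have h : J * J = -1 := hJ
    rw [sphPoly_eq_sq z hI]
    simp only [pt, add_sub_cancel_left, smul_mul_smul_comm, h, smul_neg]
    rw [← sq, ← Quaternion.coe_mul_eq_smul, mul_one, neg_add_cancel]

lemma sphPoly_conj (p q : ℍ) {a : ℍ} (ha : a ≠ 0) :
    sphPoly p (a⁻¹ * q * a) = a⁻¹ * sphPoly p q * a := by
  rw [sphPoly_eq, sphPoly_eq]
  have h : a⁻¹ * ((Quaternion.normSq p : ℝ) : ℍ) * a = ((Quaternion.normSq p : ℝ) : ℍ) := by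
    rw [mul_assoc, Quaternion.coe_commutes, ← mul_assoc, inv_mul_cancel₀ ha, one_mul]
  have h2 : a⁻¹ * q * a * (a⁻¹ * q * a) = a⁻¹ * (q * q) * a := by
    calc a⁻¹ * q * a * (a⁻¹ * q * a) = a⁻¹ * q * (a * a⁻¹) * q * a := by noncomm_ring
      _ = _ := by rw [mul_inv_cancel₀ ha]; noncomm_ring
  rw [h2, mul_add, add_mul, h, mul_sub, sub_mul, mul_smul_comm, smul_mul_assoc]

lemma sphPoly_pow_conj (p q : ℍ) (n : ℕ) {a : ℍ} (ha : a ≠ 0) :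
    a * sphPoly p (a⁻¹ * q * a) ^ n = sphPoly p q ^ n * a := by
  rw [sphPoly_conj p q ha]
  induction n with
  | zero => simp
  | succ n ih =>
    rw [pow_succ, ← mul_assoc, ih, pow_succ]
    simp only [mul_assoc]
    rw [mul_inv_cancel_left₀ ha]

lemma sphPoly_pow_comm (p q : ℍ) (n : ℕ) : q * sphPoly p q ^ n = sphPoly p q ^ n * q := by
  have h : Commute q (sphPoly p q) := by
    rw [sphPoly_eq]
    have h1 : Commute q (((Quaternion.normSq p : ℝ) : ℍ)) :=
      (Quaternion.coe_commutes _ q).symm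
    exact (((Commute.refl q).mul_right (Commute.refl q)).sub_right
      ((Commute.refl q).smul_right _)).add_right h1
  exact h.pow_right n

lemma subset_closure_of_pole {Ω U : Set ℍ} {f : ℍ → ℍ} (h : IsSemiRegularOn Ω U f) :
    Ω ⊆ closure U := by
  intro p hp
  by_cases hpU : p ∈ U
  · exact subset_closure hpU
  obtain ⟨n, W, hWo, -, hpW, -, hWU, -⟩ := h.pole p ⟨hp, hpU⟩
  rw [mem_closure_iff]
  intro N hN hpN
  have hc : Continuous fun t : ℝ => p + (t : ℍ) := by
    exact continuous_const.add Quaternion.continuous_coe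
  have h0 : ∀ᶠ t : ℝ in nhds 0, p + (t : ℍ) ∈ N ∩ W :=
    hc.continuousAt.eventually ((hN.inter hWo).mem_nhds (by simpa using ⟨hpN, hpW⟩))
  obtain ⟨t, ht, ht0⟩ := ((h0.filter_mono nhdsWithin_le_nhds).and
    (self_mem_nhdsWithin : {(0 : ℝ)}ᶜ ∈ nhdsWithin 0 {(0 : ℝ)}ᶜ)).exists
  refine ⟨_, ht.1, hWU ⟨ht.2, ?_⟩⟩
  rintro ⟨z, I, hI, J, hJ, h1, h2⟩
  have e1 := congrArg (fun q : ℍ => q.re) h1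
  have e2 := congrArg (fun q : ℍ => q.re) h2
  simp only [re_pt hI, re_pt hJ, Quaternion.re_add, Quaternion.re_coe] at e1 e2
  exact ht0 (by simp only [Set.mem_singleton_iff]; linarith)

lemma subset_closure_inter {Ω U V : Set ℍ} (hU : IsOpen U) (hUΩ : U ⊆ Ω)
    (h1 : Ω ⊆ closure U) (h2 : Ω ⊆ closure V) : Ω ⊆ closure (U ∩ V) := by
  intro p hp
  rw [mem_closure_iff]
  intro N hN hpN
  obtain ⟨u, huN, huU⟩ := mem_closure_iff.1 (h1 hp) N hN hpN
  obtain ⟨v, hv, hvV⟩ := mem_closure_iff.1 (h2 (hUΩ huU)) (N ∩ U) (hN.inter hU) ⟨huN, huU⟩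
  exact ⟨v, hv.1, hv.2, hvV⟩

/-! Stem functions -/

/-- `F₁ + ι F₂` is a holomorphic stem function inducing `f` on `U`. -/
def HasStem (U : Set ℍ) (f : ℍ → ℍ) (F₁ F₂ : ℂ → ℍ) : Prop :=
  ∀ I ∈ ImUnits, ∀ z, pt I z ∈ U → f (pt I z) = F₁ z + I * F₂ z ∧
    ∃ A B : ℂ →L[ℝ] ℍ, HasFDerivAt F₁ A z ∧ HasFDerivAt F₂ B z ∧
      A 1 = B Complex.I ∧ A Complex.I = -B 1

lemma HasStem.mono {U V : Set ℍ} {f : ℍ → ℍ} {F₁ F₂ : ℂ → ℍ} (h : HasStem U f F₁ F₂)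
    (hVU : V ⊆ U) : HasStem V f F₁ F₂ :=
  fun I hI z hz => h I hI z (hVU hz)

lemma eventually_pt {U : Set ℍ} (hU : IsOpen U) {I : ℍ} {z : ℂ} (hz : pt I z ∈ U) :
    ∀ᶠ w in nhds z, pt I w ∈ U :=
  (continuous_pt I).continuousAt.eventually (hU.mem_nhds hz)

lemma HasStem.isSliceRegular {U : Set ℍ} {f : ℍ → ℍ} {F₁ F₂ : ℂ → ℍ} (hU : IsOpen U)
    (h : HasStem U f F₁ F₂) : IsSliceRegular U f := by
  refine ⟨⟨F₁, F₂, fun I hI z hz => (h I hI z hz).1⟩, fun I hI z hz => ?_⟩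
  obtain ⟨-, A, B, hA, hB, h1, h2⟩ := h I hI z hz
  have hII : I * I = -1 := hI
  refine ⟨A + I • B, ?_, ?_⟩
  · refine (hA.add (hB.const_mul I)).congr_of_eventuallyEq ?_
    filter_upwards [eventually_pt hU hz] with w hw
    exact (h I hI w hw).1
  · simp only [add_apply, smul_apply, smul_eq_mul, h1, h2,
      mul_add, ← mul_assoc, hII]
    noncomm_ring

lemma IsSliceRegular.exists_stem {U : Set ℍ} {f : ℍ → ℍ} (hU : IsOpen U) (hc : IsCircular U)
    (h : IsSliceRegular U f) : ∃ F₁ F₂, HasStem U f F₁ F₂ := by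
  obtain ⟨⟨F₁, F₂, hF⟩, hd⟩ := h
  refine ⟨F₁, F₂, fun I hI z hz => ⟨hF I hI z hz, ?_⟩⟩
  have hII : I * I = -1 := hI
  have hI' := neg_mem_imUnits hI
  have hz' := hc z I hI _ hI' hz
  obtain ⟨L, hL, hL0⟩ := hd I hI z hz
  obtain ⟨M, hM, hM0⟩ := hd (-I) hI' z hz'
  have hLI : L Complex.I = I * L 1 := by
    have := congrArg (fun x => I * x) hL0
    simp only [mul_add, ← mul_assoc, hII, mul_zero, neg_one_mul] at this
    exact (eq_of_sub_eq_zero (by rw [sub_eq_add_neg]; exact this)).symm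
  have hMI : M Complex.I = -(I * M 1) := by
    have := congrArg (fun x => I * x) hM0
    simp only [mul_add, ← mul_assoc, mul_neg, hII, mul_zero, neg_neg, one_mul] at this
    exact eq_neg_of_add_eq_zero_right this
  refine ⟨(2⁻¹ : ℝ) • (L + M), (2⁻¹ : ℝ) • ((-I) • (L - M)), ?_, ?_, ?_, ?_⟩
  · refine ((hL.add hM).const_smul (2⁻¹ : ℝ)).congr_of_eventuallyEq ?_
    filter_upwards [eventually_pt hU hz, eventually_pt hU hz'] with w hw hw'
    simp only [Pi.smul_apply, Pi.add_apply, hF I hI w hw, hF _ hI' w hw']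
    rw [neg_mul, add_add_add_comm, add_neg_cancel, add_zero, ← two_smul ℝ, smul_smul]
    norm_num
  · refine (((hL.sub hM).const_mul (-I)).const_smul (2⁻¹ : ℝ)).congr_of_eventuallyEq ?_
    filter_upwards [eventually_pt hU hz, eventually_pt hU hz'] with w hw hw'
    simp only [Pi.smul_apply, Pi.sub_apply, hF I hI w hw, hF _ hI' w hw']
    have : -I * (F₁ w + I * F₂ w - (F₁ w + -I * F₂ w)) = (2 : ℝ) • F₂ w := by
      rw [two_smul]
      calc _ = -(I * I) * F₂ w - (I * I) * F₂ w := by noncomm_ring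
        _ = _ := by rw [hII]; noncomm_ring
    rw [this, smul_smul]
    norm_num
  · simp only [add_apply, smul_apply,
      sub_apply, smul_eq_mul, hLI, hMI]
    congr 1
    calc L 1 + M 1 = -(-1) * L 1 + -(-1) * M 1 := by noncomm_ring
      _ = _ := by rw [← hII]; noncomm_ring
  · simp only [add_apply, smul_apply,
      sub_apply, smul_eq_mul, hLI, hMI, ← smul_neg]
    congr 1
    noncomm_ring

lemma HasStem.const (U : Set ℍ) (a : ℍ) : HasStem U (fun _ => a) (fun _ => a) (fun _ => 0) :=
  fun I _ z _ => ⟨by simp, 0, 0, hasFDerivAt_const _ _, hasFDerivAt_const _ _, by simp, by simp⟩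

lemma HasStem.add {U : Set ℍ} {f g : ℍ → ℍ} {F₁ F₂ G₁ G₂ : ℂ → ℍ} (hf : HasStem U f F₁ F₂)
    (hg : HasStem U g G₁ G₂) : HasStem U (f + g) (F₁ + G₁) (F₂ + G₂) := by
  intro I hI z hz
  obtain ⟨e, A, B, hA, hB, h1, h2⟩ := hf I hI z hz
  obtain ⟨e', A', B', hA', hB', h1', h2'⟩ := hg I hI z hz
  refine ⟨?_, A + A', B + B', hA.add hA', hB.add hB', ?_, ?_⟩
  · simp only [Pi.add_apply, e, e', mul_add]; abel
  · simp [h1, h1']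
  · simp only [add_apply, h2, h2']; abel

/-- The `*`-product in terms of a slice representation of the right factor. -/
lemma starMul_apply {U : Set ℍ} (hU : IsCircular U) (f : ℍ → ℍ) {g : ℍ → ℍ} {G₁ G₂ : ℂ → ℍ}
    (hg : ∀ I ∈ ImUnits, ∀ z, pt I z ∈ U → g (pt I z) = G₁ z + I * G₂ z) {I : ℍ}
    (hI : I ∈ ImUnits) {z : ℂ} (hz : pt I z ∈ U) :
    starMul f g (pt I z) = f (pt I z) * G₁ z + I * f (pt I z) * G₂ z := by
  unfold starMul
  split_ifs with h
  · simp [h]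
  · have hJ := conj_mem_imUnits hI h
    rw [conj_pt z h, hg _ hJ z (hU z I hI _ hJ hz), mul_add]
    congr 1
    simp only [← mul_assoc, mul_inv_cancel₀ h, one_mul]

lemma HasStem.starMul {U : Set ℍ} (hU : IsCircular U) {f g : ℍ → ℍ} {F₁ F₂ G₁ G₂ : ℂ → ℍ}
    (hf : HasStem U f F₁ F₂) (hg : HasStem U g G₁ G₂) :
    HasStem U (starMul f g) (F₁ * G₁ - F₂ * G₂) (F₁ * G₂ + F₂ * G₁) := by
  intro I hI z hz
  have hII : I * I = -1 := hI
  obtain ⟨e, A, B, hA, hB, h1, h2⟩ := hf I hI z hz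
  obtain ⟨-, A', B', hA', hB', h1', h2'⟩ := hg I hI z hz
  refine ⟨?_, _, _, (hA.mul' hA').sub (hB.mul' hB'), (hA.mul' hB').add (hB.mul' hA'), ?_, ?_⟩
  · rw [starMul_apply hU f (fun I hI z hz => (hg I hI z hz).1) hI hz, e]
    simp only [Pi.add_apply, Pi.sub_apply, Pi.mul_apply]
    calc _ = F₁ z * G₁ z + (I * I) * (F₂ z * G₂ z) + I * (F₁ z * G₂ z + F₂ z * G₁ z) := by
          noncomm_ring
      _ = _ := by rw [hII]; noncomm_ring
  · simp [h1, h2, h1', h2']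
    abel
  · simp [h1, h2, h1', h2']
    abel

lemma imDir_pt {I : ℍ} (hI : I ∈ ImUnits) {z : ℂ} (hz : z.im ≠ 0) (x : ℍ) :
    imDir (pt I z) * x * imDir (pt I z) = I * x * I := by
  have hn : ‖I‖ = 1 := by
    have := imUnits_normSq hI
    rw [Quaternion.normSq_eq_norm_mul_self] at this
    nlinarith [norm_nonneg I]
  unfold imDir
  rw [im_pt hI, norm_smul, hn, mul_one, smul_smul, smul_mul_assoc, smul_mul_smul_comm]
  have : ‖z.im‖⁻¹ * z.im * (‖z.im‖⁻¹ * z.im) = 1 := by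
    rw [Real.norm_eq_abs]
    have h2 : |z.im| ≠ 0 := abs_ne_zero.2 hz
    field_simp
    rw [sq_abs]
  rw [this, one_smul]

lemma regConj_apply {I : ℍ} (hI : I ∈ ImUnits) {f : ℍ → ℍ} {z : ℂ} {a b : ℍ}
    (h1 : f (pt I z) = a + I * b) (h2 : f (pt (-I) z) = a - I * b) :
    regConj f (pt I z) = star a + I * star b := by
  have hII : I * I = -1 := hI
  have key : (2⁻¹ : ℝ) • (star (f (pt I z)) + star (f (pt (-I) z)) +
      I * (star (f (pt I z)) - star (f (pt (-I) z))) * I) = star a + I * star b := by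
    rw [h1, h2]
    simp only [star_add, star_sub, star_mul, imUnits_star hI]
    rw [inv_smul_eq_iff₀ (by norm_num), two_smul]
    calc _ = star a + star a - I * (star b) * (I * I) - I * star b * (I * I) := by noncomm_ring
      _ = _ := by rw [hII]; noncomm_ring
  rw [← key]
  unfold regConj
  rw [star_pt hI]
  by_cases hz : z.im = 0
  · have : pt (-I) z = pt I z := by simp [pt, hz]
    rw [this]
    simp
  · rw [imDir_pt hI hz]

lemma HasStem.regConj {U : Set ℍ} (hU : IsCircular U) {f : ℍ → ℍ} {F₁ F₂ : ℂ → ℍ}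
    (hf : HasStem U f F₁ F₂) :
    HasStem U (regConj f) (fun z => star (F₁ z)) (fun z => star (F₂ z)) := by
  intro I hI z hz
  obtain ⟨e, A, B, hA, hB, h1, h2⟩ := hf I hI z hz
  have hI' := neg_mem_imUnits hI
  have e' := (hf (-I) hI' z (hU z I hI _ hI' hz)).1
  have : StarModule ℝ ℍ := ⟨fun r a => by simp⟩
  refine ⟨regConj_apply hI e (by rw [e']; noncomm_ring), _, _, hA.star, hB.star, ?_, ?_⟩
  · simp [h1]
  · simp [h2]

/-- The description of `fᶜ` through the components of `f` with respect to `1, i, j, k`: if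
`f = ∑ f_ℓ e_ℓ` where `f_ℓ` has a real stem function, then `fᶜ = ∑ f_ℓ e_ℓᶜ`. -/
lemma regConj_components {U : Set ℍ} (hU : IsCircular U) {f : ℍ → ℍ} (e : Fin 4 → ℍ)
    (c : Fin 4 → ℍ → ℍ) (P Q : Fin 4 → ℂ → ℝ)
    (hc : ∀ l, ∀ I ∈ ImUnits, ∀ z, pt I z ∈ U → c l (pt I z) = (P l z : ℍ) + I * (Q l z : ℍ))
    (hf : ∀ q ∈ U, f q = ∑ l, c l q * e l) :
    ∀ q ∈ U, regConj f q = ∑ l, c l q * star (e l) := by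
  intro q hq
  obtain ⟨I, hI, z, rfl⟩ := exists_pt q
  have hI' := neg_mem_imUnits hI
  have hq' := hU z I hI _ hI' hq
  rw [regConj_apply hI (a := ∑ l, (P l z : ℍ) * e l) (b := ∑ l, (Q l z : ℍ) * e l)]
  · simp only [star_sum, star_mul, Quaternion.star_coe, Finset.mul_sum, ← Finset.sum_add_distrib]
    refine Finset.sum_congr rfl fun l _ => ?_
    rw [hc l I hI z hq, ← Quaternion.coe_commutes, ← Quaternion.coe_commutes]
    noncomm_ring
  · rw [hf _ hq, Finset.mul_sum, ← Finset.sum_add_distrib]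
    refine Finset.sum_congr rfl fun l _ => ?_
    rw [hc l I hI z hq]
    noncomm_ring
  · rw [hf _ hq', Finset.mul_sum, ← Finset.sum_sub_distrib]
    refine Finset.sum_congr rfl fun l _ => ?_
    rw [hc l _ hI' z hq']
    noncomm_ring

/-! Closure of semi-regular functions under the operations -/

lemma IsSemiRegularOn.pole' {Ω U : Set ℍ} {f : ℍ → ℍ} (h : IsSemiRegularOn Ω U f) {p : ℍ}
    (hp : p ∈ Ω) : IsPoleOrRemovable Ω U f p := by
  by_cases hpU : p ∈ U
  · exact ⟨0, U, h.isOpen, h.circular, hpU, h.subset, Set.sdiff_subset, f, h.regular, by simp⟩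
  · exact h.pole p ⟨hp, hpU⟩

lemma IsSemiRegularOn.const (Ω : CircularDomain) (a : ℍ) :
    IsSemiRegularOn Ω.carrier Ω.carrier (fun _ => a) :=
  ⟨Ω.isOpen, Ω.circular, subset_rfl, (HasStem.const _ a).isSliceRegular Ω.isOpen,
    fun _ hp => absurd hp.1 hp.2⟩

lemma IsSliceRegular.add {U V : Set ℍ} {f g : ℍ → ℍ} (hU : IsOpen U) (hU' : IsCircular U)
    (hV : IsOpen V) (hV' : IsCircular V) (hf : IsSliceRegular U f) (hg : IsSliceRegular V g) :
    IsSliceRegular (U ∩ V) (f + g) := by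
  obtain ⟨F₁, F₂, hF⟩ := hf.exists_stem hU hU'
  obtain ⟨G₁, G₂, hG⟩ := hg.exists_stem hV hV'
  exact ((hF.mono Set.inter_subset_left).add (hG.mono Set.inter_subset_right)).isSliceRegular
    (hU.inter hV)

lemma IsSliceRegular.starMul {U V : Set ℍ} {f g : ℍ → ℍ} (hU : IsOpen U) (hU' : IsCircular U)
    (hV : IsOpen V) (hV' : IsCircular V) (hf : IsSliceRegular U f) (hg : IsSliceRegular V g) :
    IsSliceRegular (U ∩ V) (starMul f g) := by
  obtain ⟨F₁, F₂, hF⟩ := hf.exists_stem hU hU'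
  obtain ⟨G₁, G₂, hG⟩ := hg.exists_stem hV hV'
  exact ((hF.mono Set.inter_subset_left).starMul (hU'.inter hV')
    (hG.mono Set.inter_subset_right)).isSliceRegular (hU.inter hV)

lemma IsSliceRegular.regConj {U : Set ℍ} {f : ℍ → ℍ} (hU : IsOpen U) (hU' : IsCircular U)
    (hf : IsSliceRegular U f) : IsSliceRegular U (regConj f) := by
  obtain ⟨F₁, F₂, hF⟩ := hf.exists_stem hU hU'
  exact (hF.regConj hU').isSliceRegular hU

/-- The powers of `Δ_p` are (slice preserving) regular functions. -/
lemma sphPoly_pow_stem (p : ℍ) (n : ℕ) :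
    ∃ P Q : ℂ → ℝ, HasStem Set.univ (fun q => sphPoly p q ^ n) (fun z => (P z : ℍ))
      (fun z => (Q z : ℍ)) := by
  obtain ⟨J, hJ, w, rfl⟩ := exists_pt p
  let R : ℂ → ℂ := fun z => ((z - w.re) ^ 2 + (w.im : ℂ) ^ 2) ^ n
  refine ⟨fun z => (R z).re, fun z => (R z).im, fun I hI z _ => ⟨?_, ?_⟩⟩
  · have hII : I * I = -1 := hI
    have hmul : ∀ a b : ℂ, pt I a * pt I b = pt I (a * b) := by
      intro a b
      simp only [pt, mul_add, add_mul, Complex.mul_re, Complex.mul_im, hII,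
        coe_eq_smul_one, smul_mul_assoc, mul_smul_comm, one_mul, mul_one]
      module
    have hpow : ∀ a : ℂ, pt I a ^ n = pt I (a ^ n) := by
      intro a
      induction n with
      | zero => simp [pt]
      | succ n ih => rw [pow_succ, ih, hmul, ← pow_succ]
    have h1 : sphPoly (pt J w) (pt I z) = pt I ((z - w.re) ^ 2 + (w.im : ℂ) ^ 2) := by
      have : pt I z - (w.re : ℍ) = pt I (z - w.re) := by
        simp [pt]; abel
      rw [sphPoly_eq_sq w hJ, this, hmul]
      rw [← sq]
      simp only [pt, ← Complex.ofReal_pow, Complex.add_re, Complex.add_im, Complex.ofReal_re,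
        Complex.ofReal_im, coe_eq_smul_one]
      module
    change sphPoly (pt J w) (pt I z) ^ n = _
    rw [h1, hpow]
    change pt I (R z) = _
    rw [← Quaternion.coe_commutes, Quaternion.coe_mul_eq_smul]
    rfl
  · have hR : DifferentiableAt ℂ R z := by fun_prop
    have hd := hR.hasDerivAt.complexToReal_fderiv
    have hcoe : ∀ (ℓ : ℂ →L[ℝ] ℝ), HasFDerivAt (fun z => ((ℓ (R z) : ℝ) : ℍ))
        ((Algebra.linearMap ℝ ℍ).toContinuousLinearMap.comp
          (ℓ.comp (deriv R z • (1 : ℂ →L[ℝ] ℂ)))) z := by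
      intro ℓ
      exact (Algebra.linearMap ℝ ℍ).toContinuousLinearMap.hasFDerivAt.comp z
        (ℓ.hasFDerivAt.comp z hd)
    refine ⟨_, _, hcoe Complex.reCLM, hcoe Complex.imCLM, ?_, ?_⟩
    · simp
    · simp

lemma starMul_of_commute {f : ℍ → ℍ} (g : ℍ → ℍ) {q : ℍ} (h : q * f q = f q * q) :
    starMul f g q = f q * g q := by
  unfold starMul
  split_ifs with h0
  · simp [h0]
  · rw [mul_assoc, h, inv_mul_cancel_left₀ h0]

lemma IsSliceRegular.sphPoly_mul {U : Set ℍ} {f : ℍ → ℍ} (hU : IsOpen U) (hU' : IsCircular U)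
    (hf : IsSliceRegular U f) (p : ℍ) (n : ℕ) :
    IsSliceRegular U (fun q => sphPoly p q ^ n * f q) := by
  obtain ⟨P, Q, h⟩ := sphPoly_pow_stem p n
  have h1 := ((h.mono (Set.subset_univ U)).isSliceRegular hU).starMul hU hU' hU hU' hf
  rw [Set.inter_self] at h1
  convert h1 using 1
  ext1 q
  exact (starMul_of_commute f (f := fun q => sphPoly p q ^ n) (sphPoly_pow_comm p q n)).symm

lemma IsSemiRegularOn.add {Ω U V : Set ℍ} {f g : ℍ → ℍ} (hf : IsSemiRegularOn Ω U f)
    (hg : IsSemiRegularOn Ω V g) : IsSemiRegularOn Ω (U ∩ V) (f + g) := by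
  refine ⟨hf.isOpen.inter hg.isOpen, hf.circular.inter hg.circular,
    Set.inter_subset_left.trans hf.subset,
    hf.regular.add hf.isOpen hf.circular hg.isOpen hg.circular hg.regular, fun p hp => ?_⟩
  obtain ⟨n, W, hW, hW', hpW, hWΩ, hWU, φ, hφ, hfφ⟩ := hf.pole' hp.1
  obtain ⟨m, T, hT, hT', hpT, -, hTV, ψ, hψ, hgψ⟩ := hg.pole' hp.1
  refine ⟨m + n, W ∩ T, hW.inter hT, hW'.inter hT', ⟨hpW, hpT⟩,
    Set.inter_subset_left.trans hWΩ, fun q hq => ⟨hWU ⟨hq.1.1, hq.2⟩, hTV ⟨hq.1.2, hq.2⟩⟩, _,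
    (hφ.sphPoly_mul hW hW' p m).add hW hW' hT hT' (hψ.sphPoly_mul hT hT' p n), fun q hq => ?_⟩
  simp only [Pi.add_apply]
  rw [← hfφ q ⟨hq.1.1, hq.2⟩, ← hgψ q ⟨hq.1.2, hq.2⟩, mul_add, pow_add]
  congr 1
  · rw [mul_assoc]
  · rw [← pow_add, add_comm, pow_add, mul_assoc]

lemma IsSemiRegularOn.starMul {Ω U V : Set ℍ} {f g : ℍ → ℍ} (hf : IsSemiRegularOn Ω U f)
    (hg : IsSemiRegularOn Ω V g) : IsSemiRegularOn Ω (U ∩ V) (starMul f g) := by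
  refine ⟨hf.isOpen.inter hg.isOpen, hf.circular.inter hg.circular,
    Set.inter_subset_left.trans hf.subset,
    hf.regular.starMul hf.isOpen hf.circular hg.isOpen hg.circular hg.regular, fun p hp => ?_⟩
  obtain ⟨n, W, hW, hW', hpW, hWΩ, hWU, φ, hφ, hfφ⟩ := hf.pole' hp.1
  obtain ⟨m, T, hT, hT', hpT, -, hTV, ψ, hψ, hgψ⟩ := hg.pole' hp.1
  refine ⟨n + m, W ∩ T, hW.inter hT, hW'.inter hT', ⟨hpW, hpT⟩,
    Set.inter_subset_left.trans hWΩ, fun q hq => ⟨hWU ⟨hq.1.1, hq.2⟩, hTV ⟨hq.1.2, hq.2⟩⟩, _,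
    hφ.starMul hW hW' hT hT' hψ, fun q hq => ?_⟩
  have hD : sphPoly p q ≠ 0 := fun h => hq.2 ((sphPoly_eq_zero_iff p q).1 h)
  have hDn : sphPoly p q ^ n ≠ 0 := pow_ne_zero _ hD
  have e := hfφ q ⟨hq.1.1, hq.2⟩
  by_cases h0 : f q = 0
  · have h1 : φ q = 0 := by rw [← e, h0, mul_zero]
    simp [SliceRegular.starMul, h0, h1]
  · have h1 : φ q ≠ 0 := by rw [← e]; exact mul_ne_zero hDn h0
    have h2 : (φ q)⁻¹ * q * φ q = (f q)⁻¹ * q * f q := by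
      rw [← e, mul_inv_rev]
      calc _ = (f q)⁻¹ * ((sphPoly p q ^ n)⁻¹ * (q * sphPoly p q ^ n)) * f q := by noncomm_ring
        _ = _ := by rw [sphPoly_pow_comm, inv_mul_cancel_left₀ hDn]
    have h3 : (f q)⁻¹ * q * f q ∈ T \ sphere p := by
      refine ⟨hT'.conj_mem hq.1.2 h0, fun h => ?_⟩
      rw [← sphPoly_eq_zero_iff, sphPoly_conj p q h0] at h
      simp [h0, hD] at h
    simp only [SliceRegular.starMul, h0, h1, if_false, h2]
    rw [← hgψ _ h3, ← e, pow_add]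
    calc _ = sphPoly p q ^ n * (sphPoly p q ^ m * f q) * g ((f q)⁻¹ * q * f q) := by noncomm_ring
      _ = _ := by rw [← sphPoly_pow_conj p q m h0]; noncomm_ring

lemma star_mem_sphere {p q : ℍ} (h : q ∈ sphere p) : star q ∈ sphere p := by
  obtain ⟨z, I, hI, J, hJ, rfl, rfl⟩ := h
  exact ⟨z, I, hI, -J, neg_mem_imUnits hJ, rfl, star_pt hJ z⟩

lemma IsSemiRegularOn.regConj {Ω U : Set ℍ} {f : ℍ → ℍ} (hf : IsSemiRegularOn Ω U f) :
    IsSemiRegularOn Ω U (regConj f) := by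
  refine ⟨hf.isOpen, hf.circular, hf.subset,
    hf.regular.regConj hf.isOpen hf.circular, fun p hp => ?_⟩
  obtain ⟨n, W, hW, hW', hpW, hWΩ, hWU, φ, hφ, hfφ⟩ := hf.pole p hp
  refine ⟨n, W, hW, hW', hpW, hWΩ, hWU, _, hφ.regConj hW hW', fun q hq => ?_⟩
  obtain ⟨P, Q, hD⟩ := sphPoly_pow_stem p n
  obtain ⟨⟨F₁, F₂, hF⟩, -⟩ := hf.regular
  obtain ⟨I, hI, z, rfl⟩ := exists_pt q
  have hI' := neg_mem_imUnits hI
  have hII : I * I = -1 := hI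
  have hq' : pt (-I) z ∈ W \ sphere p := by
    refine ⟨hW' z I hI _ hI' hq.1, fun h => hq.2 ?_⟩
    have := star_mem_sphere h
    rwa [star_pt hI', neg_neg] at this
  have d1 : sphPoly p (pt I z) ^ n = _ := (hD I hI z trivial).1
  have d2 : sphPoly p (pt (-I) z) ^ n = _ := (hD (-I) hI' z trivial).1
  have f1 := hF I hI z (hWU hq)
  have f2 := hF _ hI' z (hWU hq')
  rw [regConj_apply hI f1 (by rw [f2]; noncomm_ring),
    regConj_apply hI (f := φ) (a := P z • F₁ z - Q z • F₂ z) (b := P z • F₂ z + Q z • F₁ z), d1]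
  · simp only [coe_eq_smul_one, star_add, star_sub, Quaternion.star_smul, mul_add, add_mul,
      smul_mul_assoc, mul_smul_comm, one_mul, mul_one, ← mul_assoc, hII, neg_mul]
    module
  · rw [← hfφ _ hq, d1, f1]
    simp only [coe_eq_smul_one, mul_add, add_mul,
      smul_mul_assoc, mul_smul_comm, one_mul, mul_one, ← mul_assoc, hII, neg_mul]
    module
  · rw [← hfφ _ hq', d2, f2]
    simp only [coe_eq_smul_one, mul_add, add_mul,
      smul_mul_assoc, mul_smul_comm, one_mul, mul_one, ← mul_assoc, hII, neg_mul, mul_neg, neg_neg]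
    module

/-! The ring of slice semi-regular functions -/

lemma SemiEq.refl (Ω : CircularDomain) (f : ℍ → ℍ) : SemiEq Ω f f :=
  ⟨Ω.carrier, Ω.isOpen, Ω.circular, subset_rfl, subset_closure, fun _ _ => rfl⟩

lemma SemiEq.symm {Ω : CircularDomain} {f g : ℍ → ℍ} (h : SemiEq Ω f g) : SemiEq Ω g f := by
  obtain ⟨V, h1, h2, h3, h4, h5⟩ := h
  exact ⟨V, h1, h2, h3, h4, h5.symm⟩

lemma SemiEq.trans {Ω : CircularDomain} {f g k : ℍ → ℍ} (h : SemiEq Ω f g) (h' : SemiEq Ω g k) :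
    SemiEq Ω f k := by
  obtain ⟨V, h1, h2, h3, h4, h5⟩ := h
  obtain ⟨W, k1, k2, k3, k4, k5⟩ := h'
  exact ⟨V ∩ W, h1.inter k1, h2.inter k2, Set.inter_subset_left.trans h3,
    subset_closure_inter h1 h3 h4 k4, fun q hq => (h5 hq.1).trans (k5 hq.2)⟩

lemma IsSemiRegularOn.semiEq {Ω : CircularDomain} {U : Set ℍ} {f g h : ℍ → ℍ}
    (hf : IsSemiRegularOn Ω.carrier U f) (hgh : Set.EqOn g h U) : SemiEq Ω g h :=
  ⟨U, hf.isOpen, hf.circular, hf.subset, subset_closure_of_pole hf, hgh⟩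

/-- Semi-regular functions up to equality away from singularities. -/
def semiSetoid (Ω : CircularDomain) : Setoid {f : ℍ → ℍ // IsSemiRegular Ω f} where
  r f g := SemiEq Ω f.1 g.1
  iseqv := ⟨fun f => SemiEq.refl Ω f.1, SemiEq.symm, SemiEq.trans⟩

/-- The set `SEM(Ω)` of slice semi-regular functions on `Ω`. -/
def SEM (Ω : CircularDomain) : Type := Quotient (semiSetoid Ω)

namespace SEM

variable {Ω : CircularDomain}

/-- The element of `SEM(Ω)` given by a slice semi-regular function. -/
def mk (f : ℍ → ℍ) (hf : IsSemiRegular Ω f) : SEM Ω := Quotient.mk (semiSetoid Ω) ⟨f, hf⟩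

lemma ind {P : SEM Ω → Prop} (h : ∀ f hf, P (mk f hf)) (x : SEM Ω) : P x :=
  Quotient.ind (fun f => h f.1 f.2) x

lemma mk_eq_mk {f g : ℍ → ℍ} {hf : IsSemiRegular Ω f} {hg : IsSemiRegular Ω g} :
    mk f hf = mk g hg ↔ SemiEq Ω f g :=
  ⟨fun h => Quotient.exact (s := semiSetoid Ω) h, fun h => Quotient.sound (s := semiSetoid Ω) h⟩

lemma isSemiRegular_const (a : ℍ) : IsSemiRegular Ω (fun _ => a) := ⟨_, IsSemiRegularOn.const Ω a⟩

lemma isSemiRegular_add {f g : ℍ → ℍ} (hf : IsSemiRegular Ω f) (hg : IsSemiRegular Ω g) :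
    IsSemiRegular Ω (f + g) := by
  obtain ⟨U, hU⟩ := hf
  obtain ⟨V, hV⟩ := hg
  exact ⟨_, hU.add hV⟩

lemma isSemiRegular_starMul {f g : ℍ → ℍ} (hf : IsSemiRegular Ω f) (hg : IsSemiRegular Ω g) :
    IsSemiRegular Ω (starMul f g) := by
  obtain ⟨U, hU⟩ := hf
  obtain ⟨V, hV⟩ := hg
  exact ⟨_, hU.starMul hV⟩

lemma isSemiRegular_regConj {f : ℍ → ℍ} (hf : IsSemiRegular Ω f) : IsSemiRegular Ω (regConj f) := by
  obtain ⟨U, hU⟩ := hf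
  exact ⟨_, hU.regConj⟩

lemma isSemiRegular_neg {f : ℍ → ℍ} (hf : IsSemiRegular Ω f) : IsSemiRegular Ω (-f) := by
  have h := isSemiRegular_starMul (isSemiRegular_const (-1)) hf
  convert h using 1
  ext1 q
  simp [starMul_of_commute (f := fun _ => (-1 : ℍ)) f (q := q) (by simp)]

instance : Zero (SEM Ω) := ⟨mk (fun _ => 0) (isSemiRegular_const 0)⟩

instance : One (SEM Ω) := ⟨mk (fun _ => 1) (isSemiRegular_const 1)⟩

instance : Add (SEM Ω) :=
  ⟨Quotient.map₂ (fun f g => ⟨f.1 + g.1, isSemiRegular_add f.2 g.2⟩) (by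
    intro f f' hff g g' hgg
    obtain ⟨V, h1, h2, h3, h4, h5⟩ : SemiEq Ω f.1 f'.1 := hff
    obtain ⟨W, k1, k2, k3, k4, k5⟩ : SemiEq Ω g.1 g'.1 := hgg
    exact ⟨V ∩ W, h1.inter k1, h2.inter k2, Set.inter_subset_left.trans h3,
      subset_closure_inter h1 h3 h4 k4, fun q hq => congrArg₂ (· + ·) (h5 hq.1) (k5 hq.2)⟩)⟩

instance : Neg (SEM Ω) :=
  ⟨Quotient.map (fun f => ⟨-f.1, isSemiRegular_neg f.2⟩) (by
    intro f f' hff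
    obtain ⟨V, h1, h2, h3, h4, h5⟩ : SemiEq Ω f.1 f'.1 := hff
    exact ⟨V, h1, h2, h3, h4, fun q hq => congrArg (- ·) (h5 hq)⟩)⟩

/-- Multiplication on `SEM(Ω)` is the `*`-product. -/
instance : Mul (SEM Ω) :=
  ⟨Quotient.map₂ (fun f g => ⟨starMul f.1 g.1, isSemiRegular_starMul f.2 g.2⟩) (by
    intro f f' hff g g' hgg
    obtain ⟨V, h1, h2, h3, h4, h5⟩ : SemiEq Ω f.1 f'.1 := hff
    obtain ⟨W, k1, k2, k3, k4, k5⟩ : SemiEq Ω g.1 g'.1 := hgg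
    refine ⟨V ∩ W, h1.inter k1, h2.inter k2, Set.inter_subset_left.trans h3,
      subset_closure_inter h1 h3 h4 k4, fun q hq => ?_⟩
    have e := h5 hq.1
    by_cases h0 : f.1 q = 0
    · simp [starMul, h0, ← e]
    · have h0' : f'.1 q ≠ 0 := fun h => h0 (e.trans h)
      simp only [starMul, if_neg h0, if_neg h0', ← e]
      rw [k5 (k2.conj_mem hq.2 h0)])⟩

lemma mk_add {f g : ℍ → ℍ} (hf : IsSemiRegular Ω f) (hg : IsSemiRegular Ω g) :
    mk f hf + mk g hg = mk (f + g) (isSemiRegular_add hf hg) := rfl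

lemma mk_mul {f g : ℍ → ℍ} (hf : IsSemiRegular Ω f) (hg : IsSemiRegular Ω g) :
    mk f hf * mk g hg = mk (starMul f g) (isSemiRegular_starMul hf hg) := rfl

lemma mk_neg {f : ℍ → ℍ} (hf : IsSemiRegular Ω f) : -mk f hf = mk (-f) (isSemiRegular_neg hf) := rfl

lemma zero_def : (0 : SEM Ω) = mk (fun _ => 0) (isSemiRegular_const 0) := rfl

lemma one_def : (1 : SEM Ω) = mk (fun _ => 1) (isSemiRegular_const 1) := rfl

lemma mk_congr {f g : ℍ → ℍ} {hf : IsSemiRegular Ω f} {hg : IsSemiRegular Ω g} (h : f = g) :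
    mk f hf = mk g hg := by subst h; rfl

instance : Ring (SEM Ω) where
  add_assoc := ind fun f hf => ind fun g hg => ind fun h hh => mk_congr (add_assoc f g h)
  zero_add := ind fun f hf => mk_congr (zero_add f)
  add_zero := ind fun f hf => mk_congr (add_zero f)
  add_comm := ind fun f hf => ind fun g hg => mk_congr (add_comm f g)
  neg_add_cancel := ind fun f hf => mk_congr (neg_add_cancel f)
  nsmul := nsmulRec
  zsmul := zsmulRec
  mul_assoc := ind fun f hf => ind fun g hg => ind fun h hh => by
    obtain ⟨U, hU⟩ := hh
    obtain ⟨H₁, H₂, hH⟩ := hU.regular.1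
    refine mk_eq_mk.2 (hU.semiEq (g := starMul (starMul f g) h) (h := starMul f (starMul g h))
      fun q hq => ?_)
    obtain ⟨I, hI, z, rfl⟩ := exists_pt q
    rw [starMul_apply hU.circular _ hH hI hq]
    by_cases h0 : f (pt I z) = 0
    · simp [starMul, h0]
    · have hJ := conj_mem_imUnits hI h0
      have e : ∀ k : ℍ → ℍ, starMul f k (pt I z) =
          f (pt I z) * k (pt ((f (pt I z))⁻¹ * I * f (pt I z)) z) := by
        intro k
        rw [starMul, if_neg h0, conj_pt z h0]
      rw [e, e, starMul_apply hU.circular g hH hJ (hU.circular z I hI _ hJ hq), mul_add]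
      congr 1
      · rw [mul_assoc]
      · simp only [← mul_assoc, mul_inv_cancel₀ h0, one_mul]
  left_distrib := ind fun f hf => ind fun g hg => ind fun h hh => mk_congr <| by
    ext1 q
    by_cases h0 : f q = 0
    · simp [starMul, h0]
    · simp [starMul, h0, mul_add]
  right_distrib := ind fun f hf => ind fun g hg => ind fun h hh => by
    obtain ⟨U, hU⟩ := hh
    obtain ⟨H₁, H₂, hH⟩ := hU.regular.1
    refine mk_eq_mk.2 (hU.semiEq (g := starMul (f + g) h) (h := starMul f h + starMul g h)
      fun q hq => ?_)
    obtain ⟨I, hI, z, rfl⟩ := exists_pt q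
    simp only [Pi.add_apply]
    rw [starMul_apply hU.circular _ hH hI hq, starMul_apply hU.circular _ hH hI hq,
      starMul_apply hU.circular _ hH hI hq]
    simp only [Pi.add_apply]
    noncomm_ring
  zero_mul := ind fun f hf => mk_congr <| by ext1 q; simp [starMul]
  mul_zero := ind fun f hf => mk_congr <| by ext1 q; simp [starMul]
  one_mul := ind fun f hf => mk_congr <| by ext1 q; simp [starMul]
  mul_one := ind fun f hf => mk_congr <| by
    ext1 q
    by_cases h0 : f q = 0 <;> simp [starMul, h0]

/-- The constant function `a ∈ ℍ`, as an element of `SEM(Ω)`. -/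
def const (Ω : CircularDomain) (a : ℍ) : SEM Ω := mk (fun _ => a) (isSemiRegular_const a)

/-- The regular conjugate `fᶜ`. -/
def conj (f : SEM Ω) : SEM Ω :=
  Quotient.map (sa := semiSetoid Ω) (sb := semiSetoid Ω)
    (fun f => ⟨regConj f.1, isSemiRegular_regConj f.2⟩) (by
    intro f f' hff
    obtain ⟨V, h1, h2, h3, h4, h5⟩ : SemiEq Ω f.1 f'.1 := hff
    refine ⟨V, h1, h2, h3, h4, fun q hq => ?_⟩
    simp only [regConj, h5 hq, h5 (h2.star_mem hq)]) f

/-- The "real part" `f₀ = (f + fᶜ) / 2`. -/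
def realPart (f : SEM Ω) : SEM Ω := const Ω (1 / 2) * (f + conj f)

/-- The "vector part" `f_v = f - f₀`. -/
def vecPart (f : SEM Ω) : SEM Ω := f - realPart f

/-- The symmetrized function `fˢ = f * fᶜ`. -/
def symmetrized (f : SEM Ω) : SEM Ω := f * conj f

end SEM

open SEM in
/-- The subring `SEM_ℝ(Ω)` of slice preserving functions: those mapping, on their domain of
regularity `U`, each `U ∩ ℂ_I` into `ℂ_I`. -/
def SEMR (Ω : CircularDomain) : Subring (SEM Ω) where
  carrier := {x | ∃ U f, ∃ hf : IsSemiRegularOn Ω.carrier U f,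
    (∀ I ∈ ImUnits, ∀ z, pt I z ∈ U → ∃ w, f (pt I z) = pt I w) ∧ x = mk f ⟨U, hf⟩}
  zero_mem' := ⟨Ω.carrier, fun _ => 0, IsSemiRegularOn.const Ω 0,
    fun I _ z _ => ⟨0, by simp [pt]⟩, rfl⟩
  one_mem' := ⟨Ω.carrier, fun _ => 1, IsSemiRegularOn.const Ω 1,
    fun I _ z _ => ⟨1, by simp [pt]⟩, rfl⟩
  add_mem' := by
    rintro _ _ ⟨U, f, hf, h, rfl⟩ ⟨V, g, hg, k, rfl⟩
    refine ⟨U ∩ V, f + g, hf.add hg, fun I hI z hz => ?_, rfl⟩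
    obtain ⟨a, ha⟩ := h I hI z hz.1
    obtain ⟨b, hb⟩ := k I hI z hz.2
    refine ⟨a + b, ?_⟩
    rw [Pi.add_apply, ha, hb]
    simp only [pt, Complex.add_re, Complex.add_im, coe_eq_smul_one]
    module
  neg_mem' := by
    rintro _ ⟨U, f, hf, h, rfl⟩
    have hf' : IsSemiRegularOn Ω.carrier U (-f) := by
      have := (IsSemiRegularOn.const Ω (-1)).starMul hf
      rw [Set.inter_eq_right.2 hf.subset] at this
      convert this using 1
      ext1 q
      simp [starMul_of_commute (f := fun _ => (-1 : ℍ)) f (q := q) (by simp)]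
    refine ⟨U, -f, hf', fun I hI z hz => ?_, rfl⟩
    obtain ⟨a, ha⟩ := h I hI z hz
    refine ⟨-a, ?_⟩
    rw [Pi.neg_apply, ha]
    simp only [pt, Complex.neg_re, Complex.neg_im, coe_eq_smul_one]
    module
  mul_mem' := by
    rintro _ _ ⟨U, f, hf, h, rfl⟩ ⟨V, g, hg, k, rfl⟩
    refine ⟨U ∩ V, starMul f g, hf.starMul hg, fun I hI z hz => ?_, rfl⟩
    have hII : I * I = -1 := hI
    have hmul : ∀ a b : ℂ, pt I a * pt I b = pt I (a * b) := by
      intro a b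
      simp only [pt, mul_add, add_mul, Complex.mul_re, Complex.mul_im, hII,
        coe_eq_smul_one, smul_mul_assoc, mul_smul_comm, one_mul, mul_one]
      module
    obtain ⟨a, ha⟩ := h I hI z hz.1
    obtain ⟨b, hb⟩ := k I hI z hz.2
    refine ⟨a * b, ?_⟩
    rw [starMul_of_commute, ha, hb, hmul]
    rw [ha, hmul, hmul, mul_comm]

/-- Slice preserving functions are central in `SEM(Ω)`. -/
lemma SEMR.commute {Ω : CircularDomain} {x : SEM Ω} (hx : x ∈ SEMR Ω) (y : SEM Ω) :
    x * y = y * x := by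
  obtain ⟨U, f, hf, h, rfl⟩ := hx
  induction y using SEM.ind with | h g hg => ?_
  obtain ⟨⟨F₁, F₂, hF⟩, -⟩ := hf.regular
  refine SEM.mk_eq_mk.2 (hf.semiEq fun q hq => ?_)
  obtain ⟨I, hI, z, rfl⟩ := exists_pt q
  have hUJ : ∀ J ∈ ImUnits, pt J z ∈ U := fun J hJ => hf.circular z I hI J hJ hq
  have hcJ : ∀ J : ℍ, ∀ w, Commute J (pt J w) := by
    intro J w
    unfold pt
    exact Commute.add_right (Quaternion.coe_commutes _ J).symm ((Commute.refl J).smul_right _)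
  have hJ : ∀ J ∈ ImUnits, Commute J (F₁ z) ∧ Commute J (F₂ z) := by
    intro J hJ
    have hJJ : J * J = -1 := hJ
    have hJ' := neg_mem_imUnits hJ
    have c1 : Commute J (F₁ z + J * F₂ z) := by
      obtain ⟨w, hw⟩ := h J hJ z (hUJ J hJ)
      rw [← hF J hJ z (hUJ J hJ), hw]
      exact hcJ J w
    have c2 : Commute J (F₁ z - J * F₂ z) := by
      obtain ⟨w, hw⟩ := h _ hJ' z (hUJ _ hJ')
      have e := hF _ hJ' z (hUJ _ hJ')
      rw [neg_mul, ← sub_eq_add_neg] at e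
      rw [← e, hw]
      exact (Commute.neg_left_iff).1 (hcJ (-J) w)
    have d1 : Commute J (F₁ z) := by
      have := (c1.add_right c2).smul_right (2⁻¹ : ℝ)
      rwa [add_add_sub_cancel, ← two_smul ℝ, smul_smul, inv_mul_cancel₀ two_ne_zero,
        one_smul] at this
    have d2 : Commute J (J * F₂ z) := by simpa using c1.sub_right d1
    refine ⟨d1, ?_⟩
    have := (Commute.refl J).neg_right.mul_right d2
    rwa [neg_mul, ← mul_assoc, hJJ, neg_one_mul, neg_neg] at this
  have hall : ∀ a : ℍ, Commute a (F₁ z) ∧ Commute a (F₂ z) := by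
    intro a
    obtain ⟨J, hJ1, w, rfl⟩ := exists_pt a
    have k := hJ J hJ1
    unfold pt
    exact ⟨Commute.add_left (Quaternion.coe_commutes _ _) (k.1.smul_left _),
      Commute.add_left (Quaternion.coe_commutes _ _) (k.2.smul_left _)⟩
  have hfc : pt I z * f (pt I z) = f (pt I z) * pt I z := by
    rw [hF I hI z hq]
    exact (hall _).1.add_right ((hcJ I z).symm.mul_right (hall _).2)
  rw [starMul_of_commute g hfc, starMul_apply hf.circular g hF hI hq, hF I hI z hq, add_mul,
    (hall (g (pt I z))).1.eq, mul_assoc, ← (hall (g (pt I z))).2.eq, mul_assoc]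

/-- The Sylvester operator `S_{f,g}(χ) = f * χ + χ * g`, as a `SEM_ℝ(Ω)`-linear map. -/
def sylvester {Ω : CircularDomain} (f g : SEM Ω) : SEM Ω →ₗ[SEMR Ω] SEM Ω where
  toFun χ := f * χ + χ * g
  map_add' χ ψ := by noncomm_ring
  map_smul' c χ := by
    simp only [Subring.smul_def, smul_eq_mul, RingHom.id_apply, mul_add]
    rw [← mul_assoc, ← SEMR.commute c.2 f]
    noncomm_ring

end SliceRegular

end

open SliceRegular

/-! Write K for `SEMR Ω`. The ring `SEM Ω` is the quaternion algebra ℍ[K], with regular conjugation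
as quaternionic conjugation (`ofQuaternion_injective`, `ofQuaternion_surjective`,
`conj_ofQuaternion`), and K is a field of characteristic ≠ 2. After that, the theorem is algebra
over K.

K is a field because its elements come from conjugation-symmetric meromorphic functions `G` of one
complex variable: as `Ω` is connected, the identity theorem makes 1/`G` an inverse unless `G`
vanishes identically (`exists_inv_ofStem`).

In ℍ[K] the condition on real parts cancels the scalars and leaves aχ + χb = 0, with a, b nonzero
and pure and a² = b² scalar. Elements ah - hb are solutions, since a(ah - hb) + (ah - hb)b = a²h -
hb² = 0. Conversely, pick c with ac + ca = 1; a solution χ then equals a(cχ) - (cχ)b. Given an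
invertible solution u, the map χ ↦ χu⁻¹ carries the solutions onto the centralizer of a, which is K
+ Ka. This gives dimension 2, and (a + r)u is a second invertible solution for a suitable scalar r.

ℍ[K] can have zero divisors: if `Ω` misses the real axis, `imDir` is slice preserving with square
-1. A nonzero solution need not be invertible, so u is found by showing that the quadratic form h ↦
N(ah - hb) is not identically zero (`exists_isUnit_sub`). -/

noncomputable section

namespace SliceRegular

open Filter Topology

/-! ### Slice preserving functions and their complex stem functions -/

section

open ComplexConjugate

/-- The representative `x + i |y|` in the closed upper half plane of the sphere of `x + I y`. -/
def toUpper (q : ℍ) : ℂ := ⟨q.re, ‖q.im‖⟩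

/-- The slice preserving function induced by `G`, which should satisfy `G (conj z) = conj (G z)`. -/
def ofStem (G : ℂ → ℂ) (q : ℍ) : ℍ := pt (imDir q) (G (toUpper q))

lemma pt_add (I : ℍ) (a b : ℂ) : pt I a + pt I b = pt I (a + b) := by
  simp only [pt, Complex.add_re, Complex.add_im, coe_eq_smul_one]
  module

lemma pt_mul {I : ℍ} (hI : I ∈ ImUnits) (a b : ℂ) : pt I a * pt I b = pt I (a * b) := by
  have hII : I * I = -1 := hI
  simp only [pt, mul_add, add_mul, Complex.mul_re, Complex.mul_im, hII,
    coe_eq_smul_one, smul_mul_assoc, mul_smul_comm, one_mul, mul_one]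
  module

lemma pt_pow {I : ℍ} (hI : I ∈ ImUnits) (a : ℂ) (n : ℕ) : pt I a ^ n = pt I (a ^ n) := by
  induction n with
  | zero => simp [pt]
  | succ n ih => rw [pow_succ, ih, pt_mul hI, ← pow_succ]

lemma pt_conj (I : ℍ) (z : ℂ) : pt I (conj z) = pt (-I) z := by simp [pt]

lemma pt_eq_zero_iff {I : ℍ} (hI : I ∈ ImUnits) (z : ℂ) : pt I z = 0 ↔ z = 0 := by
  rw [← Quaternion.normSq_eq_zero, normSq_pt hI]
  constructor
  · intro h
    apply Complex.ext <;> simp <;> nlinarith [sq_nonneg z.re, sq_nonneg z.im]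
  · rintro rfl
    simp

lemma norm_imUnit {I : ℍ} (hI : I ∈ ImUnits) : ‖I‖ = 1 := by
  have := imUnits_normSq hI
  rw [Quaternion.normSq_eq_norm_mul_self] at this
  nlinarith [norm_nonneg I]

lemma toUpper_pt {I : ℍ} (hI : I ∈ ImUnits) (z : ℂ) : toUpper (pt I z) = ⟨z.re, |z.im|⟩ := by
  rw [toUpper, re_pt hI, im_pt hI, norm_smul, norm_imUnit hI, mul_one, Real.norm_eq_abs]

lemma toUpper_pt_of_nonneg {I : ℍ} (hI : I ∈ ImUnits) {z : ℂ} (hz : 0 ≤ z.im) :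
    toUpper (pt I z) = z := by
  rw [toUpper_pt hI, abs_of_nonneg hz]

lemma toUpper_pt_of_nonpos {I : ℍ} (hI : I ∈ ImUnits) {z : ℂ} (hz : z.im ≤ 0) :
    toUpper (pt I z) = conj z := by
  rw [toUpper_pt hI, abs_of_nonpos hz]
  apply Complex.ext <;> simp

lemma exists_pt_toUpper (q : ℍ) : ∃ I ∈ ImUnits, q = pt I (toUpper q) := by
  obtain ⟨I, hI, z, rfl⟩ := exists_pt q
  rcases le_total 0 z.im with hz | hz
  · exact ⟨I, hI, by rw [toUpper_pt_of_nonneg hI hz]⟩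
  · exact ⟨-I, neg_mem_imUnits hI, by rw [toUpper_pt_of_nonpos hI hz, pt_conj, neg_neg]⟩

lemma continuous_toUpper : Continuous toUpper := by
  have : toUpper = fun q => (q.re : ℂ) + (‖q.im‖ : ℂ) * Complex.I := by
    ext1 q
    apply Complex.ext <;> simp [toUpper]
  rw [this]
  have h1 := Quaternion.continuous_re
  have h2 := Quaternion.continuous_im
  fun_prop

lemma toUpper_add_coe (q : ℍ) (t : ℝ) : toUpper (q + (t : ℍ)) = toUpper q + t := by
  apply Complex.ext <;> simp [toUpper]

/-- Preimages of sets under `toUpper` are circular. -/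
lemma isCircular_toUpper (S : Set ℂ) : IsCircular {q | toUpper q ∈ S} := by
  intro z I hI J hJ h
  simp only [Set.mem_ofPred_eq, toUpper_pt hI] at h
  simpa only [Set.mem_ofPred_eq, toUpper_pt hJ] using h

lemma mem_sphere_of_toUpper_eq {p q : ℍ} (h : toUpper q = toUpper p) : q ∈ sphere p := by
  obtain ⟨I, hI, hp⟩ := exists_pt_toUpper p
  obtain ⟨J, hJ, hq⟩ := exists_pt_toUpper q
  exact ⟨toUpper p, I, hI, J, hJ, hp, h ▸ hq⟩

/-- `G` commutes with complex conjugation. -/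
def ConjSymm (G : ℂ → ℂ) : Prop := ∀ z, G (conj z) = conj (G z)

/-- In the lower half plane `imDir` is -I, and the symmetry of `G` absorbs the sign. On the real
axis `imDir` is 0, which is harmless because `G` is real there. -/
lemma ofStem_pt {G : ℂ → ℂ} (hG : ConjSymm G) {I : ℍ} (hI : I ∈ ImUnits) (z : ℂ) :
    ofStem G (pt I z) = pt I (G z) := by
  rcases lt_trichotomy z.im 0 with hz | hz | hz
  · rw [ofStem, toUpper_pt_of_nonpos hI hz.le, imDir, im_pt hI, norm_smul, norm_imUnit hI, mul_one,
      hG, pt_conj, smul_smul, Real.norm_eq_abs, abs_of_neg hz]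
    congr 1
    rw [inv_neg, neg_mul, inv_mul_cancel₀ hz.ne]
    simp
  · have h : conj z = z := Complex.conj_eq_iff_im.2 hz
    have h2 : (G z).im = 0 := Complex.conj_eq_iff_im.1 (by rw [← hG, h])
    rw [ofStem, toUpper_pt_of_nonneg hI hz.ge]
    simp [pt, h2]
  · rw [ofStem, toUpper_pt_of_nonneg hI hz.le, imDir, im_pt hI, norm_smul, norm_imUnit hI, mul_one,
      smul_smul, Real.norm_eq_abs, abs_of_pos hz, inv_mul_cancel₀ hz.ne', one_smul]

lemma starMul_ofStem {G H : ℂ → ℂ} (hG : ConjSymm G) (hH : ConjSymm H) :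
    starMul (ofStem G) (ofStem H) = ofStem (G * H) := by
  ext1 q
  obtain ⟨I, hI, z, rfl⟩ := exists_pt q
  have hGH : ConjSymm (G * H) := fun z => by simp [hG z, hH z]
  rw [starMul_of_commute, ofStem_pt hG hI, ofStem_pt hH hI, ofStem_pt hGH hI, pt_mul hI]
  · rfl
  · rw [ofStem_pt hG hI, pt_mul hI, pt_mul hI, mul_comm]

/-- The stem function `(z - w) (z - conj w)` of `Δ_p`, where `p = x + I y` and `w = x + i y`. -/
def sphStem (w z : ℂ) : ℂ := (z - w) * (z - conj w)

lemma sphPoly_pt (w : ℂ) {I J : ℍ} (hI : I ∈ ImUnits) (hJ : J ∈ ImUnits) (z : ℂ) :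
    sphPoly (pt I w) (pt J z) = pt J (sphStem w z) := by
  have h : pt J z - (w.re : ℍ) = pt J (z - w.re) := by
    simp [pt]; abel
  have h2 : ((w.im ^ 2 : ℝ) : ℍ) = pt J ((w.im ^ 2 : ℝ) : ℂ) := by
    simp only [pt, Complex.ofReal_re, Complex.ofReal_im, zero_smul, add_zero]
  rw [sphPoly_eq_sq w hI, h, pt_mul hJ, h2, pt_add, sphStem]
  congr 1
  have h3 : ((w.im ^ 2 : ℝ) : ℂ) = (w.re - w) * (w.re - conj w) := by
    apply Complex.ext <;> simp [sq]
  have h4 : w + conj w = 2 * w.re := by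
    rw [Complex.add_conj]; push_cast; rfl
  rw [h3]
  linear_combination (z - w.re) * h4

/-- A function with holomorphic complex stem function is slice regular. -/
lemma isSliceRegular_ofStem {U : Set ℍ} (hU : IsOpen U) {G : ℂ → ℂ} (hG : ConjSymm G)
    (hd : ∀ q ∈ U, DifferentiableAt ℂ G (toUpper q)) : IsSliceRegular U (ofStem G) := by
  have hd' : ∀ I ∈ ImUnits, ∀ z, pt I z ∈ U → DifferentiableAt ℂ G z := by
    intro I hI z hz
    have h := hd _ hz
    rcases le_total 0 z.im with h0 | h0
    · rwa [toUpper_pt_of_nonneg hI h0] at h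
    · rw [toUpper_pt_of_nonpos hI h0] at h
      -- Differentiability is only given in the closed upper half plane; Schwarz reflection carries
      -- it to the lower one.
      have h2 := h.conj_conj
      rw [Complex.conj_conj] at h2
      have h3 : conj ∘ G ∘ conj = G := by
        ext1 w
        simp [hG w]
      rwa [h3] at h2
  have hst : HasStem U (ofStem G) (fun z => ((G z).re : ℍ)) (fun z => ((G z).im : ℍ)) := by
    intro I hI z hz
    refine ⟨?_, ?_⟩
    · rw [ofStem_pt hG hI, ← Quaternion.coe_commutes, Quaternion.coe_mul_eq_smul]
      rfl
    · have hd := (hd' I hI z hz).hasDerivAt.complexToReal_fderiv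
      have hcoe : ∀ (ℓ : ℂ →L[ℝ] ℝ), HasFDerivAt (fun z => ((ℓ (G z) : ℝ) : ℍ))
          ((Algebra.linearMap ℝ ℍ).toContinuousLinearMap.comp
            (ℓ.comp (deriv G z • (1 : ℂ →L[ℝ] ℂ)))) z := by
        intro ℓ
        exact (Algebra.linearMap ℝ ℍ).toContinuousLinearMap.hasFDerivAt.comp z
          (ℓ.hasFDerivAt.comp z hd)
      refine ⟨_, _, hcoe Complex.reCLM, hcoe Complex.imCLM, ?_, ?_⟩
      · simp
      · simp
  exact hst.isSliceRegular hU

/-- The domain of analyticity of `ofStem G` in `Ω`. -/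
def analyticSet (Ω : CircularDomain) (G : ℂ → ℂ) : Set ℍ :=
  Ω.carrier ∩ {q | toUpper q ∈ {z | AnalyticAt ℂ G z}}

lemma sphStem_conjSymm {w : ℂ} : ConjSymm (sphStem w) := by
  intro z
  simp only [sphStem, map_mul, map_sub, Complex.conj_conj]
  ring

/-- If (z - w)ⁿ clears the pole of `G` at w, then Δ_pⁿ clears the pole of the induced function on
the whole sphere: its stem function contains that factor and is conjugation-symmetric. -/
lemma isSemiRegularOn_ofStem {Ω : CircularDomain} {G : ℂ → ℂ} (hG : ConjSymm G)
    (hm : ∀ q ∈ Ω.carrier, MeromorphicAt G (toUpper q)) :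
    IsSemiRegularOn Ω.carrier (analyticSet Ω G) (ofStem G) := by
  have ho : IsOpen (analyticSet Ω G) :=
    Ω.isOpen.inter ((isOpen_analyticAt ℂ G).preimage continuous_toUpper)
  refine ⟨ho, Ω.circular.inter (isCircular_toUpper _), Set.inter_subset_left,
    isSliceRegular_ofStem ho hG fun q hq => hq.2.differentiableAt, fun p hp => ?_⟩
  set w := toUpper p with hw
  obtain ⟨n, hn⟩ := hm p hp.1
  have hev := (hm p hp.1).eventually_analyticAt
  rw [eventually_nhdsWithin_iff, eventually_nhds_iff] at hev
  obtain ⟨S, hS, hSo, hwS⟩ := hev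
  have hsymm : ConjSymm (sphStem w ^ n * G) := fun z => by
    simp [hG z, sphStem_conjSymm (w := w) z]
  have hWo : IsOpen (Ω.carrier ∩ {q | toUpper q ∈ S}) :=
    Ω.isOpen.inter (hSo.preimage continuous_toUpper)
  refine ⟨n, Ω.carrier ∩ {q | toUpper q ∈ S}, hWo,
    Ω.circular.inter (isCircular_toUpper _), ⟨hp.1, hwS⟩, Set.inter_subset_left, ?_,
    ofStem (sphStem w ^ n * G), isSliceRegular_ofStem hWo hsymm fun q hq => ?_, fun q _ => ?_⟩
  · rintro q ⟨hq, hqp⟩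
    exact ⟨hq.1, hS _ hq.2 fun h => hqp (mem_sphere_of_toUpper_eq h)⟩
  · by_cases h : toUpper q = w
    · rw [h]
      have : sphStem w ^ n * G =
          (fun z => (z - conj w) ^ n) * fun z => (z - w) ^ n • G z := by
        ext1 z
        simp only [Pi.mul_apply, Pi.pow_apply, sphStem, smul_eq_mul, mul_pow]
        ring
      rw [this]
      exact DifferentiableAt.mul (by fun_prop) hn.differentiableAt
    · have : DifferentiableAt ℂ (sphStem w) (toUpper q) := by unfold sphStem; fun_prop
      exact (this.pow n).mul (hS _ hq.2 h).differentiableAt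
  · obtain ⟨I, hI, hpI⟩ := exists_pt_toUpper p
    obtain ⟨J, hJ, z, rfl⟩ := exists_pt q
    rw [hpI, ← hw, sphPoly_pt w hI hJ, ofStem_pt hG hJ, ofStem_pt hsymm hJ, pt_pow hJ, pt_mul hJ]
    rfl

lemma isSemiRegular_ofStem {Ω : CircularDomain} {G : ℂ → ℂ} (hG : ConjSymm G)
    (hm : ∀ q ∈ Ω.carrier, MeromorphicAt G (toUpper q)) : IsSemiRegular Ω (ofStem G) :=
  ⟨_, isSemiRegularOn_ofStem hG hm⟩

/-- Functions that agree away from isolated spheres define the same semi-regular function. -/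
lemma semiEq_of_eventually {Ω : CircularDomain} {f g : ℍ → ℍ} (P : ℂ → Prop)
    (hP : ∀ q ∈ Ω.carrier, ∀ᶠ w in 𝓝[≠] toUpper q, P w)
    (h : ∀ q ∈ Ω.carrier, P (toUpper q) → f q = g q) : SemiEq Ω f g := by
  refine ⟨Ω.carrier ∩ {q | toUpper q ∈ {z | ∀ᶠ w in 𝓝 z, P w}},
    Ω.isOpen.inter ((isOpen_setOfPred_eventually_nhds).preimage continuous_toUpper),
    Ω.circular.inter (isCircular_toUpper _), Set.inter_subset_left, fun p hp => ?_,
    fun q hq => h q hq.1 (Eventually.self_of_nhds hq.2)⟩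
  have h1 : ∀ᶠ w in 𝓝[≠] toUpper p, ∀ᶠ v in 𝓝 w, P v := by
    have := eventually_eventually_nhdsWithin.2 (hP p hp)
    filter_upwards [this, self_mem_nhdsWithin] with w hw hne
    rwa [isOpen_compl_singleton.nhdsWithin_eq hne] at hw
  -- Density is tested along real translates p + t: they shift `toUpper p` by t, so for small t ≠ 0
  -- they lie in the good set.
  rw [mem_closure_iff]
  intro N hN hpN
  have hc : Continuous fun t : ℝ => p + (t : ℍ) := continuous_const.add Quaternion.continuous_coe
  have h0 : ∀ᶠ t : ℝ in 𝓝[≠] 0, p + (t : ℍ) ∈ N ∩ Ω.carrier :=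
    (hc.continuousAt.eventually ((hN.inter Ω.isOpen).mem_nhds
      (by simpa using ⟨hpN, hp⟩))).filter_mono nhdsWithin_le_nhds
  have ht : Tendsto (fun t : ℝ => toUpper p + (t : ℂ)) (𝓝[≠] 0) (𝓝[≠] toUpper p) := by
    refine tendsto_nhdsWithin_iff.2 ⟨?_, ?_⟩
    · have : Continuous fun t : ℝ => toUpper p + (t : ℂ) := by fun_prop
      have h2 := this.tendsto 0
      simp only [Complex.ofReal_zero, add_zero] at h2
      exact h2.mono_left nhdsWithin_le_nhds
    · filter_upwards [self_mem_nhdsWithin] with t ht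
      simpa using ht
  obtain ⟨t, ht1, ht2⟩ := (h0.and (ht.eventually h1)).exists
  refine ⟨_, ht1.1, ht1.2, ?_⟩
  simpa only [Set.mem_ofPred_eq, toUpper_add_coe] using ht2

lemma mk_ofStem_mem_SEMR {Ω : CircularDomain} {G : ℂ → ℂ} (hG : ConjSymm G)
    (hm : ∀ q ∈ Ω.carrier, MeromorphicAt G (toUpper q)) :
    SEM.mk (ofStem G) (isSemiRegular_ofStem hG hm) ∈ SEMR Ω :=
  ⟨_, _, isSemiRegularOn_ofStem hG hm, fun _ hI z _ => ⟨G z, ofStem_pt hG hI z⟩, rfl⟩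

/-- A nonzero slice preserving function has a slice preserving inverse. -/
lemma exists_inv_ofStem {Ω : CircularDomain} {G : ℂ → ℂ} (hG : ConjSymm G)
    (hm : ∀ q ∈ Ω.carrier, MeromorphicAt G (toUpper q)) :
    SEM.mk (ofStem G) (isSemiRegular_ofStem hG hm) = 0 ∨
      ∃ y ∈ SEMR Ω, SEM.mk (ofStem G) (isSemiRegular_ofStem hG hm) * y = 1 := by
  have hG' : ConjSymm G⁻¹ := fun z => by simp [hG z]
  have hm' : ∀ q ∈ Ω.carrier, MeromorphicAt G⁻¹ (toUpper q) := fun q hq => (hm q hq).inv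
  have hmo : MeromorphicOn G (toUpper '' Ω.carrier) := by
    rintro _ ⟨q, hq, rfl⟩
    exact hm q hq
  -- Identity theorem: the points where `G` vanishes to infinite order form a clopen set, whose
  -- preimage in the connected set `Ω` is empty or everything.
  have hcl := hmo.isClopen_setOfPred_meromorphicOrderAt_eq_top
  let ω : Ω.carrier → toUpper '' Ω.carrier := fun q => ⟨toUpper q, q, q.2, rfl⟩
  have hω : Continuous ω := (continuous_toUpper.comp continuous_subtype_val).subtype_mk _
  have hconn : PreconnectedSpace Ω.carrier :=
    isPreconnected_iff_preconnectedSpace.1 Ω.isConnected.isPreconnected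
  rcases isClopen_iff.1 (hcl.preimage hω) with h | h
  · right
    refine ⟨_, mk_ofStem_mem_SEMR hG' hm', ?_⟩
    rw [SEM.mk_mul, SEM.one_def, SEM.mk_eq_mk, starMul_ofStem hG hG']
    -- The convention 0⁻¹ = 0 does no harm: the product need only be 1 off the isolated zeros of
    -- `G`.
    refine semiEq_of_eventually (fun z => G z ≠ 0) (fun q hq => ?_) fun q _ hq => ?_
    · rw [← meromorphicOrderAt_ne_top_iff_eventually_ne_zero (hm q hq)]
      intro h2
      have : (⟨q, hq⟩ : Ω.carrier) ∈ (∅ : Set Ω.carrier) := h ▸ h2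
      exact this
    · simp [ofStem, hq, pt]
  · left
    rw [SEM.zero_def, SEM.mk_eq_mk]
    refine semiEq_of_eventually (fun z => G z = 0) (fun q hq => ?_) fun q _ hq => ?_
    · rw [← meromorphicOrderAt_eq_top_iff]
      have : (⟨q, hq⟩ : Ω.carrier) ∈ Set.univ := trivial
      rw [← h] at this
      exact this
    · simp [ofStem, hq, pt]

/-! ### Meromorphy of the real part of a stem function -/

lemma exists_imUnit : ∃ I : ℍ, I ∈ ImUnits := (exists_pt 0).imp fun _ h => h.1

lemma slice_coeff_unique {a b c d : ℍ} (h : ∀ I ∈ ImUnits, a + I * b = c + I * d) :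
    a = c ∧ b = d := by
  obtain ⟨I, hI⟩ := exists_imUnit
  have hII : I * I = -1 := hI
  have h1 := h I hI
  have h2 := h (-I) (neg_mem_imUnits hI)
  have h3 : (2 : ℝ) • a = (2 : ℝ) • c := by
    calc (2 : ℝ) • a = (a + I * b) + (a + -I * b) := by rw [two_smul]; noncomm_ring
      _ = (2 : ℝ) • c := by rw [h1, h2, two_smul]; noncomm_ring
  have hac : a = c := smul_right_injective ℍ (two_ne_zero (α := ℝ)) h3
  refine ⟨hac, ?_⟩
  rw [hac] at h1
  have h4 := congrArg (fun x => -(I * x)) (add_left_cancel h1)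
  simpa only [← mul_assoc, hII, neg_mul, one_mul, neg_neg] using h4

/-- The complex stem function of the part of `F₁ + I F₂` with real coefficients. -/
def reStem (F₁ F₂ : ℂ → ℍ) (z : ℂ) : ℂ := ⟨(F₁ z).re, (F₂ z).re⟩

/-- Taking the real component of a quaternion is ℝ-linear, so the Cauchy–Riemann equations of (F₁,
F₂) pass to the pair of real components. -/
lemma HasStem.differentiableAt_reStem {U : Set ℍ} {f : ℍ → ℍ} {F₁ F₂ : ℂ → ℍ}
    (h : HasStem U f F₁ F₂) {I : ℍ} (hI : I ∈ ImUnits) {z : ℂ} (hz : pt I z ∈ U) :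
    DifferentiableAt ℂ (reStem F₁ F₂) z := by
  obtain ⟨-, A, B, hA, hB, h1, h2⟩ := h I hI z hz
  let ρ : ℍ →L[ℝ] ℂ := Complex.ofRealCLM.comp
    (LinearMap.toContinuousLinearMap
      (⟨⟨fun q => q.re, fun _ _ => rfl⟩, fun _ _ => rfl⟩ : ℍ →ₗ[ℝ] ℝ))
  have hρ : ∀ q : ℍ, ρ q = (q.re : ℂ) := fun _ => rfl
  have e : reStem F₁ F₂ = fun w => ρ (F₁ w) + Complex.I * ρ (F₂ w) := by
    ext1 w
    apply Complex.ext <;> simp [reStem, hρ]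
  have hd : HasFDerivAt (reStem F₁ F₂) (ρ.comp A + Complex.I • ρ.comp B) z := by
    rw [e]
    exact (ρ.hasFDerivAt.comp z hA).add ((ρ.hasFDerivAt.comp z hB).const_mul Complex.I)
  rw [differentiableAt_complex_iff_differentiableAt_real]
  refine ⟨hd.differentiableAt, ?_⟩
  rw [hd.fderiv]
  simp [h1, h2, mul_add, ← mul_assoc]
  ring

lemma sphStem_ne_zero (z : ℂ) : ∀ᶠ w in 𝓝[≠] z, sphStem z w ≠ 0 := by
  have h1 : ∀ᶠ w in 𝓝[≠] z, w ≠ conj z := by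
    by_cases h : z = conj z
    · rw [← h]
      exact self_mem_nhdsWithin
    · exact nhdsWithin_le_nhds (isOpen_compl_singleton.mem_nhds h)
  filter_upwards [h1, self_mem_nhdsWithin] with w hw hw'
  exact mul_ne_zero (sub_ne_zero.2 hw') (sub_ne_zero.2 hw)

/-- Singular spheres are isolated, and a sphere meets a slice in at most two points. -/
lemma eventually_mem_of_semiRegularOn {Ω U : Set ℍ} {f : ℍ → ℍ} (hU : IsSemiRegularOn Ω U f)
    {I : ℍ} (hI : I ∈ ImUnits) {z : ℂ} (hz : pt I z ∈ Ω) : ∀ᶠ w in 𝓝[≠] z, pt I w ∈ U := by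
  obtain ⟨n, W, hW, -, hpW, -, hWU, -⟩ := hU.pole' hz
  filter_upwards [(eventually_pt hW hpW).filter_mono nhdsWithin_le_nhds, sphStem_ne_zero z]
    with w hw hw'
  refine hWU ⟨hw, fun h => hw' ?_⟩
  rwa [← sphPoly_eq_zero_iff, sphPoly_pt z hI hI, pt_eq_zero_iff hI] at h

/-- Near the sphere Δⁿf = φ with φ regular. By uniqueness of slice coefficients this is an identity
of stem functions; since Δ has real coefficients, it survives taking real parts and exhibits `reStem
F₁ F₂` as a quotient of analytic functions. -/
lemma meromorphicAt_reStem {Ω U : Set ℍ} {f : ℍ → ℍ} (hU : IsSemiRegularOn Ω U f)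
    {F₁ F₂ : ℂ → ℍ} (hF : HasStem U f F₁ F₂) {I : ℍ} (hI : I ∈ ImUnits) {z : ℂ}
    (hz : pt I z ∈ Ω) : MeromorphicAt (reStem F₁ F₂) z := by
  obtain ⟨n, W, hW, hW', hpW, -, hWU, φ, hφ, hfφ⟩ := hU.pole' hz
  obtain ⟨P₁, P₂, hP⟩ := hφ.exists_stem hW hW'
  have hPa : AnalyticAt ℂ (reStem P₁ P₂) z := by
    rw [Complex.analyticAt_iff_eventually_differentiableAt]
    filter_upwards [eventually_pt hW hpW] with w hw
    exact hP.differentiableAt_reStem hI hw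
  have hSa : AnalyticAt ℂ (sphStem z) z := by unfold sphStem; fun_prop
  refine ((hSa.meromorphicAt.pow n).inv.mul hPa.meromorphicAt).congr ?_
  filter_upwards [(eventually_pt hW hpW).filter_mono nhdsWithin_le_nhds, sphStem_ne_zero z]
    with w hw hw'
  have hD : ∀ J ∈ ImUnits, pt J w ∈ W \ sphere (pt I z) := by
    refine fun J hJ => ⟨hW' w I hI J hJ hw, fun h => hw' ?_⟩
    rwa [← sphPoly_eq_zero_iff, sphPoly_pt z hI hJ, pt_eq_zero_iff hJ] at h
  set R := sphStem z w ^ n with hR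
  have key : ∀ J ∈ ImUnits, (R.re • F₁ w - R.im • F₂ w) + J * (R.re • F₂ w + R.im • F₁ w) =
      P₁ w + J * P₂ w := by
    intro J hJ
    have hJJ : J * J = -1 := hJ
    have h1 := hfφ _ (hD J hJ)
    rw [sphPoly_pt z hI hJ, pt_pow hJ, ← hR, (hF J hJ w (hWU (hD J hJ))).1,
      (hP J hJ w (hD J hJ).1).1] at h1
    rw [← h1]
    simp only [pt, coe_eq_smul_one, mul_add, add_mul,
      smul_mul_assoc, mul_smul_comm, one_mul, ← mul_assoc, hJJ, neg_mul]
    module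
  obtain ⟨k1, k2⟩ := slice_coeff_unique key
  have h3 : reStem P₁ P₂ w = R * reStem F₁ F₂ w := by
    rw [reStem, ← k1, ← k2]
    apply Complex.ext <;> simp [reStem]
  simp only [Pi.mul_apply, Pi.inv_apply, Pi.pow_apply]
  rw [h3, ← hR, inv_mul_cancel_left₀ (pow_ne_zero n hw')]

/-- The same point is written in two ways: x + J(-y) = x + (-J)y. -/
lemma HasStem.conj_eq {U : Set ℍ} (hU : IsCircular U) {f : ℍ → ℍ} {F₁ F₂ : ℂ → ℍ}
    (h : HasStem U f F₁ F₂) {I : ℍ} (hI : I ∈ ImUnits) {z : ℂ} (hz : pt I z ∈ U) :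
    F₁ (conj z) = F₁ z ∧ F₂ (conj z) = -F₂ z := by
  refine slice_coeff_unique fun J hJ => ?_
  have hJ' := neg_mem_imUnits hJ
  have h1 := hU z I hI _ hJ' hz
  have h2 := (h (-J) hJ' z h1).1
  rw [← pt_conj] at h1 h2
  rw [← (h J hJ _ h1).1, h2, neg_mul, mul_neg]

end

/-! ### Regular conjugation, and inverses of slice preserving functions -/

namespace SEM

variable {Ω : CircularDomain}

/-- Twice the real part of a semi-regular function is induced by a meromorphic function. -/
lemma exists_add_conj_eq_ofStem (x : SEM Ω) : ∃ (G : ℂ → ℂ) (hG : ConjSymm G)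
    (hm : ∀ q ∈ Ω.carrier, MeromorphicAt G (toUpper q)),
    x + x.conj = mk (ofStem G) (isSemiRegular_ofStem hG hm) := by
  induction x using SEM.ind with | h f hf => ?_
  obtain ⟨U, hU⟩ := hf
  obtain ⟨F₁, F₂, hF⟩ := hU.regular.exists_stem hU.isOpen hU.circular
  -- The stem functions are arbitrary off `U`, so twice the real part is written in a form that is
  -- symmetric on all of ℂ.
  let G : ℂ → ℂ := fun z => reStem F₁ F₂ z + starRingEnd ℂ (reStem F₁ F₂ (starRingEnd ℂ z))
  have hG : ConjSymm G := fun z => by simp [G, add_comm]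
  have hGU : ∀ I ∈ ImUnits, ∀ z, pt I z ∈ U → G z = 2 * reStem F₁ F₂ z := by
    intro I hI z hz
    obtain ⟨h1, h2⟩ := hF.conj_eq hU.circular hI hz
    have h3 : starRingEnd ℂ (reStem F₁ F₂ (starRingEnd ℂ z)) = reStem F₁ F₂ z := by
      rw [reStem, h1, h2]
      apply Complex.ext <;> simp [reStem]
    simp only [G, h3, two_mul]
  have hm : ∀ q ∈ Ω.carrier, MeromorphicAt G (toUpper q) := by
    intro q hq
    obtain ⟨I, hI, e⟩ := exists_pt_toUpper q
    rw [e] at hq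
    refine ((MeromorphicAt.const 2 _).mul (meromorphicAt_reStem hU hF hI hq)).congr ?_
    filter_upwards [eventually_mem_of_semiRegularOn hU hI hq] with w hw
    exact (hGU I hI w hw).symm
  refine ⟨G, hG, hm, mk_eq_mk.2 (hU.semiEq (g := f + regConj f) fun q hq => ?_)⟩
  obtain ⟨I, hI, z, rfl⟩ := exists_pt q
  rw [Pi.add_apply, ofStem_pt hG hI, (hF I hI z hq).1, ((hF.regConj hU.circular) I hI z hq).1,
    hGU I hI z hq]
  have h1 := Quaternion.self_add_star (F₁ z)
  have h2 := Quaternion.self_add_star (F₂ z)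
  calc _ = (F₁ z + star (F₁ z)) + I * (F₂ z + star (F₂ z)) := by noncomm_ring
    _ = _ := by
      rw [h1, h2]
      have e : (2 * reStem F₁ F₂ z) = ⟨2 * (F₁ z).re, 2 * (F₂ z).re⟩ := by
        apply Complex.ext <;> simp [reStem]
      rw [e, pt, ← Quaternion.coe_mul_eq_smul, Quaternion.coe_commutes]
      push_cast
      rfl

lemma add_conj_mem (x : SEM Ω) : x + SEM.conj x ∈ SEMR Ω := by
  obtain ⟨G, hG, hm, h⟩ := exists_add_conj_eq_ofStem x
  rw [h]
  exact mk_ofStem_mem_SEMR hG hm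

lemma conj_add (x y : SEM Ω) : SEM.conj (x + y) = SEM.conj x + SEM.conj y := by
  induction x using SEM.ind with | h f hf => ?_
  induction y using SEM.ind with | h g hg => ?_
  refine mk_congr (?_ : regConj (f + g) = regConj f + regConj g)
  ext1 q
  simp only [regConj, Pi.add_apply, star_add, ← smul_add]
  congr 1
  noncomm_ring

lemma conj_mul (x y : SEM Ω) : SEM.conj (x * y) = SEM.conj y * SEM.conj x := by
  induction x using SEM.ind with | h f hf => ?_
  induction y using SEM.ind with | h g hg => ?_
  obtain ⟨U, hU⟩ := hf
  obtain ⟨V, hV⟩ := hg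
  obtain ⟨F₁, F₂, hF⟩ := hU.regular.exists_stem hU.isOpen hU.circular
  obtain ⟨G₁, G₂, hG⟩ := hV.regular.exists_stem hV.isOpen hV.circular
  have hc := hU.circular.inter hV.circular
  have hF' := hF.mono (Set.inter_subset_left : U ∩ V ⊆ U)
  have hG' := hG.mono (Set.inter_subset_right : U ∩ V ⊆ V)
  -- The sum f + g serves only to supply `U ∩ V` as a dense circular open set.
  refine mk_eq_mk.2 ((hU.add hV).semiEq (g := regConj (starMul f g))
    (h := starMul (regConj g) (regConj f)) fun q hq => ?_)
  obtain ⟨I, hI, z, rfl⟩ := exists_pt q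
  rw [((hF'.starMul hc hG').regConj hc I hI z hq).1,
    ((hG'.regConj hc).starMul hc (hF'.regConj hc) I hI z hq).1]
  simp only [Pi.add_apply, Pi.sub_apply, Pi.mul_apply, star_add, star_sub, star_mul]
  rw [add_comm (star (G₂ z) * star (F₁ z))]

lemma conj_const (a : ℍ) : SEM.conj (const Ω a) = const Ω (star a) := by
  refine mk_eq_mk.2 ((IsSemiRegularOn.const Ω a).semiEq (g := regConj fun _ => a)
    (h := fun _ => star a) fun q hq => ?_)
  simp only [regConj, sub_self, mul_zero, zero_mul, add_zero, ← two_smul ℝ, smul_smul]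
  norm_num

lemma const_add (a b : ℍ) : const Ω (a + b) = const Ω a + const Ω b := rfl

lemma const_mul (a b : ℍ) : const Ω (a * b) = const Ω a * const Ω b := by
  refine mk_congr (?_ : (fun _ => a * b) = starMul (fun _ => a) fun _ => b)
  ext1 q
  by_cases h : a = 0 <;> simp [starMul, h]

lemma const_zero : const Ω 0 = 0 := rfl

lemma const_one : const Ω 1 = 1 := rfl

lemma const_neg (a : ℍ) : const Ω (-a) = -const Ω a := rfl

lemma const_mul_mul_const_apply {U : Set ℍ} (hU : IsCircular U) {f : ℍ → ℍ} {F₁ F₂ : ℂ → ℍ}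
    (hF : HasStem U f F₁ F₂) (a b : ℍ) {I : ℍ} (hI : I ∈ ImUnits) {z : ℂ} (hz : pt I z ∈ U) :
    starMul (starMul (fun _ => a) f) (fun _ => b) (pt I z) =
      a * F₁ z * b + I * (a * F₂ z * b) := by
  rw [((HasStem.const U a).starMul hU hF |>.starMul hU (HasStem.const U b) I hI z hz).1]
  simp [Pi.mul_apply]

/-- The quaternion `i`. -/
def unitI : ℍ := ⟨0, 1, 0, 0⟩

/-- The quaternion `j`. -/
def unitJ : ℍ := ⟨0, 0, 1, 0⟩

/-- The quaternion `k`. -/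
def unitK : ℍ := ⟨0, 0, 0, 1⟩

@[simp] lemma unitI_re : unitI.re = 0 := rfl
@[simp] lemma unitI_imI : unitI.imI = 1 := rfl
@[simp] lemma unitI_imJ : unitI.imJ = 0 := rfl
@[simp] lemma unitI_imK : unitI.imK = 0 := rfl
@[simp] lemma unitJ_re : unitJ.re = 0 := rfl
@[simp] lemma unitJ_imI : unitJ.imI = 0 := rfl
@[simp] lemma unitJ_imJ : unitJ.imJ = 1 := rfl
@[simp] lemma unitJ_imK : unitJ.imK = 0 := rfl
@[simp] lemma unitK_re : unitK.re = 0 := rfl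
@[simp] lemma unitK_imI : unitK.imI = 0 := rfl
@[simp] lemma unitK_imJ : unitK.imJ = 0 := rfl
@[simp] lemma unitK_imK : unitK.imK = 1 := rfl

lemma sum_star_mul_mul (q : ℍ) : q + -unitI * q * unitI +
    -unitJ * q * unitJ + -unitK * q * unitK =
      (q + star q) + (q + star q) := by
  ext <;> simp
  ring

/-- This expresses conjugation through ring operations and constants. It yields both `conj_eq_self`
and `ofQuaternion_surjective` without returning to functions. -/
lemma sum_conj_const_mul_mul (x : SEM Ω) :
    x + const Ω (-unitI) * x * const Ω unitI +
      const Ω (-unitJ) * x * const Ω unitJ +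
      const Ω (-unitK) * x * const Ω unitK =
    (x + SEM.conj x) + (x + SEM.conj x) := by
  induction x using SEM.ind with | h f hf => ?_
  obtain ⟨U, hU⟩ := hf
  obtain ⟨F₁, F₂, hF⟩ := hU.regular.exists_stem hU.isOpen hU.circular
  refine mk_eq_mk.2 (hU.semiEq
    (g := f + starMul (starMul (fun _ => -unitI) f) (fun _ => unitI) +
      starMul (starMul (fun _ => -unitJ) f) (fun _ => unitJ) +
      starMul (starMul (fun _ => -unitK) f) (fun _ => unitK))
    (h := (f + regConj f) + (f + regConj f)) fun q hq => ?_)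
  obtain ⟨I, hI, z, rfl⟩ := exists_pt q
  simp only [Pi.add_apply]
  rw [const_mul_mul_const_apply hU.circular hF _ _ hI hq,
    const_mul_mul_const_apply hU.circular hF _ _ hI hq,
    const_mul_mul_const_apply hU.circular hF _ _ hI hq, (hF I hI z hq).1,
    ((hF.regConj hU.circular) I hI z hq).1]
  have h1 := sum_star_mul_mul (F₁ z)
  have h2 := congrArg (I * ·) (sum_star_mul_mul (F₂ z))
  simp only [mul_add] at h2
  have h3 := congrArg₂ (· + ·) h1 h2
  calc _ = _ := by abel
    _ = _ := h3
    _ = _ := by noncomm_ring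

lemma half_mul_add_self (x : SEM Ω) : const Ω (1 / 2) * (x + x) = x := by
  have h : (1 / 2 + 1 / 2 : ℍ) = 1 := by
    have h2 : (2 : ℍ) ≠ 0 := fun h =>
      two_ne_zero (α := ℝ) (Quaternion.coe_injective (h : ((2 : ℝ) : ℍ) = ((0 : ℝ) : ℍ)))
    rw [← two_mul, mul_one_div_cancel h2]
  rw [mul_add, ← add_mul, ← const_add, h, const_one, one_mul]

lemma add_self_injective {x y : SEM Ω} (h : x + x = y + y) : x = y := by
  rw [← half_mul_add_self x, h, half_mul_add_self]

/-- As c is central, the left side of `sum_conj_const_mul_mul` collapses to 4c. -/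
lemma conj_eq_self {c : SEM Ω} (hc : c ∈ SEMR Ω) : SEM.conj c = c := by
  have h := sum_conj_const_mul_mul c
  have e : ∀ a : ℍ, -a * a = 1 → const Ω (-a) * c * const Ω a = c := by
    intro a ha
    rw [mul_assoc, SEMR.commute hc, ← mul_assoc, ← const_mul, ha,
      const_one, one_mul]
  rw [e _ (by ext <;> simp), e _ (by ext <;> simp), e _ (by ext <;> simp)] at h
  have h2 : c + c = c + SEM.conj c := add_self_injective (by rw [← h]; abel)
  exact (add_left_cancel h2).symm

/-- Here c + c = c + cᶜ is induced by a meromorphic `G`; an inverse y of c + c gives the inverse y +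
y of c. -/
lemma exists_inv_of_mem {c : SEM Ω} (hc : c ∈ SEMR Ω) : c = 0 ∨ ∃ y ∈ SEMR Ω, c * y = 1 := by
  obtain ⟨G, hG, hm, h⟩ := exists_add_conj_eq_ofStem c
  rw [conj_eq_self hc] at h
  refine (exists_inv_ofStem hG hm).imp (fun h0 => ?_) ?_
  · rw [← h] at h0
    exact add_self_injective (by rw [h0, add_zero])
  · rintro ⟨y, hy, h1⟩
    exact ⟨y + y, add_mem hy hy, by rw [mul_add, ← add_mul, h, h1]⟩

end SEM

/-! ### The equation aχ + χb = 0 in quaternions over a field of characteristic ≠ 2 -/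

namespace PureQuaternion

variable {K : Type*} [Field K]

/-- The quaternion with given components. -/
def ofComponents (x y z w : K) : ℍ[K] := ⟨x, y, z, w⟩

@[simp] lemma ofComponents_re (x y z w : K) : (ofComponents x y z w).re = x := rfl
@[simp] lemma ofComponents_imI (x y z w : K) : (ofComponents x y z w).imI = y := rfl
@[simp] lemma ofComponents_imJ (x y z w : K) : (ofComponents x y z w).imJ = z := rfl
@[simp] lemma ofComponents_imK (x y z w : K) : (ofComponents x y z w).imK = w := rfl

/-- Used in two ways: the anticommutator always lies in K + Ka, and a pure h makes it scalar. -/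
lemma anticomm_eq {a : ℍ[K]} (ha : a.re = 0) (h : ℍ[K]) :
    a * h + h * a =
      (-2 * (a.imI * h.imI + a.imJ * h.imJ + a.imK * h.imK)) • 1 + (2 * h.re) • a := by
  ext <;> simp [ha] <;> ring

/-- A pure c along one axis where a has component t ≠ 0, with coefficient -1/(2t), suffices. Unlike
a⁻¹/2, it exists even when a² = 0. -/
lemma exists_anticomm_eq_one (h2 : (2 : K) ≠ 0) {a : ℍ[K]} (ha : a.re = 0) (ha0 : a ≠ 0) :
    ∃ c, a * c + c * a = 1 := by
  have h : a.imI ≠ 0 ∨ a.imJ ≠ 0 ∨ a.imK ≠ 0 := by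
    by_contra! h
    exact ha0 (QuaternionAlgebra.ext ha h.1 h.2.1 h.2.2)
  have e : ∀ t : K, t ≠ 0 → -2 * (t * -(2 * t)⁻¹) = 1 := fun t ht => by field_simp
  rcases h with h | h | h
  · refine ⟨ofComponents 0 (-(2 * a.imI)⁻¹) 0 0, ?_⟩
    rw [anticomm_eq ha]
    simp only [ofComponents_re, ofComponents_imI, ofComponents_imJ, ofComponents_imK,
      mul_zero, add_zero, zero_smul, e _ h, one_smul]
  · refine ⟨ofComponents 0 0 (-(2 * a.imJ)⁻¹) 0, ?_⟩
    rw [anticomm_eq ha]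
    simp only [ofComponents_re, ofComponents_imI, ofComponents_imJ, ofComponents_imK,
      mul_zero, add_zero, zero_add, zero_smul, e _ h, one_smul]
  · refine ⟨ofComponents 0 0 0 (-(2 * a.imK)⁻¹), ?_⟩
    rw [anticomm_eq ha]
    simp only [ofComponents_re, ofComponents_imI, ofComponents_imJ, ofComponents_imK,
      mul_zero, add_zero, zero_add, zero_smul, e _ h, one_smul]

/-- The centralizer of a pure quaternion. -/
lemma exists_of_commute (h2 : (2 : K) ≠ 0) {a y : ℍ[K]} (ha : a.re = 0) (ha0 : a ≠ 0)
    (hy : a * y = y * a) : ∃ s t : K, y = s • 1 + t • a := by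
  obtain ⟨c, hc⟩ := exists_anticomm_eq_one h2 ha ha0
  -- Since y commutes with a, y = y(ac + ca) = a(yc) + (yc)a, an anticommutator with a.
  refine ⟨_, _, Eq.trans ?_ (anticomm_eq ha (y * c))⟩
  rw [← mul_assoc, hy, mul_assoc, mul_assoc, ← mul_add, hc, mul_one]

lemma mul_add_mul_of_re {p q : ℍ[K]} (h : p.re = -q.re) (x : ℍ[K]) :
    p * x + x * q = p.im * x + x * q.im := by
  ext <;> simp [h] <;> ring

lemma mul_add_mul_star_of_re {p q : ℍ[K]} (h : p.re = -q.re) (x : ℍ[K]) :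
    p * x + x * star q = p.im * x - x * q.im := by
  ext <;> simp [h] <;> ring

lemma im_mul_im_of_mul_star {p q : ℍ[K]} (h : p.im * star p.im = q.im * star q.im) :
    p.im * p.im = q.im * q.im := by
  have e : ∀ x : ℍ[K], star x.im = -x.im := fun x => by ext <;> simp
  rwa [e, e, mul_neg, mul_neg, neg_inj] at h

lemma exists_add_self_eq (h2 : (2 : K) ≠ 0) (q : ℍ[K]) : ∃ r, r + r = q :=
  ⟨(2 : K)⁻¹ • q, by rw [← add_smul, ← two_mul, mul_inv_cancel₀ h2, one_smul]⟩

lemma mul_self_eq {a : ℍ[K]} (ha : a.re = 0) :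
    a * a = (-(a.imI ^ 2 + a.imJ ^ 2 + a.imK ^ 2) : K) • 1 := by
  ext <;> simp [ha] <;> ring

lemma isUnit_of_normSq_ne_zero {a : ℍ[K]} (h : Quaternion.normSq a ≠ 0) : IsUnit a := by
  have e : (Quaternion.normSq a)⁻¹ • ((Quaternion.normSq a : K) : ℍ[K]) = 1 := by
    rw [← Quaternion.coe_smul, smul_eq_mul, inv_mul_cancel₀ h, Quaternion.coe_one]
  exact ⟨⟨a, (Quaternion.normSq a)⁻¹ • star a,
    by rw [mul_smul_comm, Quaternion.self_mul_star, e],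
    by rw [smul_mul_assoc, Quaternion.star_mul_self, e]⟩, rfl⟩

/-- The kernel of `χ ↦ a χ + χ b` is the image of `h ↦ a h - h b`. -/
lemma sylvester_eq_zero_iff (h2 : (2 : K) ≠ 0) {a b : ℍ[K]} (ha : a.re = 0) (hb : b.re = 0)
    (ha0 : a ≠ 0) (hab : a * a = b * b) (χ : ℍ[K]) :
    a * χ + χ * b = 0 ↔ ∃ h, χ = a * h - h * b := by
  constructor
  · intro h
    obtain ⟨c, hc⟩ := exists_anticomm_eq_one h2 ha ha0
    refine ⟨c * χ, ?_⟩
    calc χ = (a * c + c * a) * χ - c * (a * χ + χ * b) := by rw [hc, h, one_mul, mul_zero, sub_zero]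
      _ = _ := by noncomm_ring
  · rintro ⟨h, rfl⟩
    calc _ = a * a * h - h * (b * b) := by noncomm_ring
      _ = 0 := by
        rw [hab, mul_self_eq hb, smul_mul_assoc, mul_smul_comm, one_mul, mul_one, sub_self]

lemma normSq_mul_sub_mul {a b : ℍ[K]} (ha : a.re = 0) (hb : b.re = 0) (h : ℍ[K]) :
    Quaternion.normSq (a * h - h * b) =
      (a.imI * h.imI + a.imJ * h.imJ + a.imK * h.imK -
        (h.imI * b.imI + h.imJ * b.imJ + h.imK * b.imK)) ^ 2 +
      (a.imI * h.re + a.imJ * h.imK - a.imK * h.imJ -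
        (h.re * b.imI + h.imJ * b.imK - h.imK * b.imJ)) ^ 2 +
      (a.imJ * h.re + a.imK * h.imI - a.imI * h.imK -
        (h.re * b.imJ + h.imK * b.imI - h.imI * b.imK)) ^ 2 +
      (a.imK * h.re + a.imI * h.imJ - a.imJ * h.imI -
        (h.re * b.imK + h.imI * b.imJ - h.imJ * b.imI)) ^ 2 := by
  rw [Quaternion.normSq_def']
  simp [ha, hb]
  ring

/-- With N(a) = N(b), the form N(ah - hb) equals 2N(a)N(h) - 2⟨a, h b h̄⟩. If it vanished
identically, every product of a component of a with one of b would be zero, contradicting a, b ≠ 0.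
-/
lemma exists_isUnit_sub (h2 : (2 : K) ≠ 0) {a b : ℍ[K]} (ha : a.re = 0) (hb : b.re = 0)
    (ha0 : a ≠ 0) (hb0 : b ≠ 0) (hab : a * a = b * b) : ∃ h, IsUnit (a * h - h * b) := by
  by_contra! hcon
  have key : ∀ h : ℍ[K], Quaternion.normSq (a * h - h * b) = 0 := fun h => by
    by_contra h0
    exact hcon h (isUnit_of_normSq_ne_zero h0)
  have hn : a.imI ^ 2 + a.imJ ^ 2 + a.imK ^ 2 = b.imI ^ 2 + b.imJ ^ 2 + b.imK ^ 2 := by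
    have := congrArg (fun q : ℍ[K] => q.re) hab
    simp [ha, hb] at this
    linear_combination -this
  -- The values at 1, i, j, k and at their pairwise sums determine a quadratic form in four
  -- variables.
  have c1 := key 1
  have ci := key (ofComponents 0 1 0 0)
  have cj := key (ofComponents 0 0 1 0)
  have ck := key (ofComponents 0 0 0 1)
  have c1i := key (ofComponents 1 1 0 0)
  have c1j := key (ofComponents 1 0 1 0)
  have c1k := key (ofComponents 1 0 0 1)
  have cij := key (ofComponents 0 1 1 0)
  have cik := key (ofComponents 0 1 0 1)
  have cjk := key (ofComponents 0 0 1 1)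
  rw [normSq_mul_sub_mul ha hb] at c1 ci cj ck c1i c1j c1k cij cik cjk
  simp only [Quaternion.re_one, Quaternion.imI_one, Quaternion.imJ_one, Quaternion.imK_one,
    ofComponents_re, ofComponents_imI, ofComponents_imJ, ofComponents_imK, mul_zero, mul_one,
    zero_mul, one_mul, add_zero, zero_add, sub_zero, zero_sub]
    at c1 ci cj ck c1i c1j c1k cij cik cjk
  clear key hcon hab
  obtain ⟨a0, a1, a2, a3⟩ := a
  obtain ⟨b0, b1, b2, b3⟩ := b
  simp only at *
  subst ha hb
  have hb' : b1 ≠ 0 ∨ b2 ≠ 0 ∨ b3 ≠ 0 := by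
    by_contra! h
    exact hb0 (QuaternionAlgebra.ext rfl h.1 h.2.1 h.2.2)
  have e : ∀ x : K, 8 * x = 0 → x = 0 := fun x hx => by
    have : (8 : K) ≠ 0 := by
      have : (8 : K) = 2 ^ 3 := by norm_num
      rw [this]; exact pow_ne_zero _ h2
    exact (mul_eq_zero.1 hx).resolve_left this
  have p11 : a1 * b1 = 0 := e _ (by grind)
  have p22 : a2 * b2 = 0 := e _ (by grind)
  have p33 : a3 * b3 = 0 := e _ (by grind)
  have p12 : a1 * b2 = 0 := e _ (by grind)
  have p21 : a2 * b1 = 0 := e _ (by grind)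
  have p13 : a1 * b3 = 0 := e _ (by grind)
  have p31 : a3 * b1 = 0 := e _ (by grind)
  have p23 : a2 * b3 = 0 := e _ (by grind)
  have p32 : a3 * b2 = 0 := e _ (by grind)
  apply ha0
  rcases hb' with h | h | h
  · exact QuaternionAlgebra.ext rfl (by simpa [h] using p11) (by simpa [h] using p21)
      (by simpa [h] using p31)
  · exact QuaternionAlgebra.ext rfl (by simpa [h] using p12) (by simpa [h] using p22)
      (by simpa [h] using p32)
  · exact QuaternionAlgebra.ext rfl (by simpa [h] using p13) (by simpa [h] using p23)
      (by simpa [h] using p33)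

/-- N(a + t) = N(a) + t², so t = 0 works if N(a) ≠ 0, and t = 1 otherwise. -/
lemma exists_isUnit_add_smul {a : ℍ[K]} (ha : a.re = 0) : ∃ t : K, IsUnit (a + t • 1) := by
  by_cases h : a.imI ^ 2 + a.imJ ^ 2 + a.imK ^ 2 = 0
  · refine ⟨1, isUnit_of_normSq_ne_zero ?_⟩
    have : Quaternion.normSq (a + (1 : K) • 1) =
        1 + (a.imI ^ 2 + a.imJ ^ 2 + a.imK ^ 2) := by
      rw [Quaternion.normSq_def']; simp [ha]; ring
    rw [this, h, add_zero]
    exact one_ne_zero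
  · refine ⟨0, isUnit_of_normSq_ne_zero ?_⟩
    have : Quaternion.normSq (a + (0 : K) • 1) =
        a.imI ^ 2 + a.imJ ^ 2 + a.imK ^ 2 := by
      rw [Quaternion.normSq_def']; simp [ha]
    rwa [this]

/-- The solutions of `a χ + χ b = 0` have a basis of invertible elements. -/
lemma exists_units_spanning (h2 : (2 : K) ≠ 0) {a b : ℍ[K]} (ha : a.re = 0) (hb : b.re = 0)
    (ha0 : a ≠ 0) (hb0 : b ≠ 0) (hab : a * a = b * b) :
    ∃ u v : ℍ[K], IsUnit u ∧ IsUnit v ∧ a * u + u * b = 0 ∧ a * v + v * b = 0 ∧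
      (∀ s t : K, s • u + t • v = 0 → s = 0 ∧ t = 0) ∧
      ∀ χ, a * χ + χ * b = 0 → ∃ s t : K, s • u + t • v = χ := by
  obtain ⟨h, hu⟩ := exists_isUnit_sub h2 ha hb ha0 hb0 hab
  have huL := (sylvester_eq_zero_iff h2 ha hb ha0 hab _).2 ⟨h, rfl⟩
  generalize a * h - h * b = u at hu huL
  obtain ⟨r, hr⟩ := exists_isUnit_add_smul ha
  refine ⟨u, (a + r • 1) * u, hu, hr.mul hu, huL, ?_, fun s t hst => ?_, fun χ hχ => ?_⟩
  -- Left multiplication by a + r preserves the solutions, because a + r commutes with a.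
  · calc _ = (a + r • 1) * (a * u + u * b) := by
          simp only [add_mul, mul_add, smul_mul_assoc, mul_smul_comm, one_mul, mul_assoc]
      _ = 0 := by rw [huL, mul_zero]
  · have h1 : (s • 1 + t • (a + r • 1)) * u = 0 := by
      rw [← hst]
      simp only [add_mul, smul_mul_assoc, one_mul]
    rw [hu.mul_left_eq_zero] at h1
    have ht : t = 0 := by
      by_contra ht
      apply ha0
      have hI := congrArg (fun q : ℍ[K] => q.imI) h1
      have hJ := congrArg (fun q : ℍ[K] => q.imJ) h1
      have hK := congrArg (fun q : ℍ[K] => q.imK) h1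
      simp [ht] at hI hJ hK
      exact QuaternionAlgebra.ext ha hI hJ hK
    have hR := congrArg (fun q : ℍ[K] => q.re) h1
    simp [ht] at hR
    exact ⟨hR, ht⟩
  · obtain ⟨⟨u, w, huw, hwu⟩, rfl⟩ := hu
    simp only at *
    have hbw : b * w = -(w * a) := by
      calc b * w = w * (a * u + u * b) * w - w * a * (u * w) + (1 - w * u) * b * w := by
            noncomm_ring
        _ = _ := by rw [huL, huw, hwu]; noncomm_ring
    -- With w = u⁻¹, the relation bw = -wa turns aχ = -χb into the statement that χw commutes with
    -- a.
    have hc : a * (χ * w) = χ * w * a := by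
      calc _ = (a * χ + χ * b) * w - χ * (b * w) := by noncomm_ring
        _ = _ := by rw [hχ, hbw]; noncomm_ring
    obtain ⟨s, t, h⟩ := exists_of_commute h2 ha ha0 hc
    -- Rewrite s + ta as (s - tr) + t(a + r).
    refine ⟨s - t * r, t, ?_⟩
    calc _ = (s • 1 + t • a) * u := by
          simp only [add_mul, smul_mul_assoc, one_mul]
          module
      _ = χ := by rw [← h, mul_assoc, hwu, mul_one]

end PureQuaternion

/-! ### `SEM Ω` as the quaternion algebra over the field `SEMR Ω` -/

namespace SEM

variable {Ω : CircularDomain}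

lemma one_ne_zero : (1 : SEM Ω) ≠ 0 := by
  intro h
  rw [one_def, zero_def, mk_eq_mk] at h
  obtain ⟨V, -, -, -, hV, hE⟩ := h
  obtain ⟨p, hp⟩ := Ω.isConnected.nonempty
  obtain ⟨q, hq⟩ := closure_nonempty_iff.1 ⟨p, hV hp⟩
  exact _root_.one_ne_zero (α := ℍ) (hE hq)

variable (Ω) in
/-- The commutative ring structure on `SEM_ℝ(Ω)`. -/
abbrev semrCommRing : CommRing (SEMR Ω) :=
  { (inferInstance : Ring (SEMR Ω)) with
    mul_comm := fun a b => Subtype.ext (SEMR.commute a.2 b) }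

lemma semr_nontrivial : Nontrivial (SEMR Ω) :=
  ⟨⟨0, 1, fun h => one_ne_zero (congrArg Subtype.val h).symm⟩⟩

attribute [local instance] semr_nontrivial

variable (Ω) in
/-- The field structure on `SEM_ℝ(Ω)`. -/
abbrev semrField : Field (SEMR Ω) :=
  letI := semrCommRing Ω
  Field.ofIsUnitOrEqZero fun a => by
    rcases exists_inv_of_mem a.2 with h | ⟨y, hy, h⟩
    · exact Or.inr (Subtype.ext h)
    · exact Or.inl (IsUnit.of_mul_eq_one (⟨y, hy⟩ : SEMR Ω) (Subtype.ext h))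

section

attribute [local instance] semrField

variable (Ω) in
/-- `SEM(Ω)` as an algebra over `SEM_ℝ(Ω)`. -/
abbrev semrAlgebra : Algebra (SEMR Ω) (SEM Ω) :=
  Algebra.ofModule (fun r x y => by simp only [Subring.smul_def, smul_eq_mul, mul_assoc])
    fun r x y => by
      simp only [Subring.smul_def, smul_eq_mul]
      rw [← mul_assoc, ← SEMR.commute r.2 x, mul_assoc]

attribute [local instance] semrAlgebra

lemma algebraMap_eq (r : SEMR Ω) : algebraMap (SEMR Ω) (SEM Ω) r = r := by
  rw [Algebra.algebraMap_eq_smul_one, Subring.smul_def, smul_eq_mul, mul_one]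

variable (Ω) in
/-- The constants `i`, `j`, `k` satisfy the quaternion relations. -/
def quaternionBasis : QuaternionAlgebra.Basis (R := SEMR Ω) (SEM Ω) (-1) 0 (-1) where
  i := const Ω unitI
  j := const Ω unitJ
  k := const Ω unitK
  i_mul_i := by
    rw [zero_smul, add_zero, neg_one_smul, ← const_mul, ← const_one, ← const_neg]
    congr 1
    ext <;> simp
  j_mul_j := by
    rw [neg_one_smul, ← const_mul, ← const_one, ← const_neg]
    congr 1
    ext <;> simp
  i_mul_j := by
    rw [← const_mul]
    congr 1
    ext <;> simp
  j_mul_i := by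
    rw [zero_smul, zero_sub, ← const_mul, ← const_neg]
    congr 1
    ext <;> simp

variable (Ω) in
/-- The homomorphism from the quaternions over `SEM_ℝ(Ω)` to `SEM(Ω)`. -/
def ofQuaternion : ℍ[SEMR Ω] →ₐ[SEMR Ω] SEM Ω := (quaternionBasis Ω).liftHom

lemma ofQuaternion_apply (q : ℍ[SEMR Ω]) : ofQuaternion Ω q =
    (q.re : SEM Ω) + q.imI * const Ω unitI + q.imJ * const Ω unitJ + q.imK * const Ω unitK := by
  change algebraMap _ _ q.re + q.imI • const Ω unitI + q.imJ • const Ω unitJ +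
    q.imK • const Ω unitK = _
  rw [algebraMap_eq]
  rfl

lemma conj_ofQuaternion (q : ℍ[SEMR Ω]) : (ofQuaternion Ω q).conj = ofQuaternion Ω (star q) := by
  have h : ∀ (r : SEMR Ω) (a : ℍ), ((r : SEM Ω) * const Ω a).conj = r * const Ω (star a) := by
    intro r a
    rw [conj_mul, conj_const, conj_eq_self r.2, SEMR.commute r.2]
  have hI : star unitI = -unitI := by ext <;> simp
  have hJ : star unitJ = -unitJ := by ext <;> simp
  have hK : star unitK = -unitK := by ext <;> simp
  rw [ofQuaternion_apply, ofQuaternion_apply, conj_add, conj_add, conj_add, h, h, h,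
    conj_eq_self q.re.2, hI, hJ, hK]
  simp [const_neg]

lemma ofQuaternion_coe (r : SEMR Ω) : ofQuaternion Ω (r : ℍ[SEMR Ω]) = r := by
  simp [ofQuaternion_apply]

lemma two_ne_zero_semr : (2 : SEMR Ω) ≠ 0 := by
  intro h
  have h1 := congrArg Subtype.val h
  have h2 : (1 : SEM Ω) + 1 = 0 + 0 := by
    rw [add_zero, one_add_one_eq_two]
    exact h1
  exact one_ne_zero (add_self_injective h2)

/-- Adding the conjugate isolates twice the real component, on which the map is the inclusion. -/
lemma re_eq_zero_of_ofQuaternion_eq_zero {q : ℍ[SEMR Ω]} (h : ofQuaternion Ω q = 0) :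
    q.re = 0 := by
  have h1 : ofQuaternion Ω (q + star q) = 0 := by
    rw [map_add, ← conj_ofQuaternion, h, ← const_zero, conj_const, star_zero, const_zero, add_zero]
  have h2 : q + star q = ((q.re + q.re : SEMR Ω) : ℍ[SEMR Ω]) := by ext <;> simp
  rw [h2, ofQuaternion_coe] at h1
  exact Subtype.ext (add_self_injective (h1.trans (add_zero 0).symm))

/-- The kernel is an ideal, and multiplying q by i, j, k brings each imaginary component, up to
sign, into the real position. -/
lemma ofQuaternion_injective : Function.Injective (ofQuaternion Ω) := by
  rw [injective_iff_map_eq_zero]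
  intro q hq
  have h : ∀ p : ℍ[SEMR Ω], (q * p).re = 0 := fun p =>
    re_eq_zero_of_ofQuaternion_eq_zero (by rw [map_mul, hq, zero_mul])
  have h1 := re_eq_zero_of_ofQuaternion_eq_zero hq
  have hI := h (PureQuaternion.ofComponents 0 1 0 0)
  have hJ := h (PureQuaternion.ofComponents 0 0 1 0)
  have hK := h (PureQuaternion.ofComponents 0 0 0 1)
  simp at hI hJ hK
  exact QuaternionAlgebra.ext h1 hI hJ hK

lemma ofQuaternion_surjective : Function.Surjective (ofQuaternion Ω) := by
  intro x
  have key := sum_conj_const_mul_mul x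
  -- Since (-ex)ᶜ = xᶜe and e² = -1, each summand of `key` is a slice preserving multiple of e plus
  -- xᶜ. Cancelling two copies of xᶜ then writes 2x in the basis 1, i, j, k.
  have hsq : ∀ e : ℍ, e * e = -1 → star e = -e →
      const Ω (-e) * x * const Ω e = (const Ω (-e) * x + (const Ω (-e) * x).conj) * const Ω e +
        x.conj := by
    intro e he hs
    rw [add_mul, conj_mul, conj_const, star_neg, hs, neg_neg, mul_assoc x.conj, ← const_mul, he,
      show const Ω (-1) = -1 from rfl]
    noncomm_ring
  have hI := hsq unitI (by ext <;> simp) (by ext <;> simp)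
  have hJ := hsq unitJ (by ext <;> simp) (by ext <;> simp)
  have hK := hsq unitK (by ext <;> simp) (by ext <;> simp)
  rw [hI, hJ, hK] at key
  let q : ℍ[SEMR Ω] := PureQuaternion.ofComponents ⟨_, add_conj_mem x⟩
    ⟨_, add_conj_mem (const Ω (-unitI) * x)⟩ ⟨_, add_conj_mem (const Ω (-unitJ) * x)⟩
    ⟨_, add_conj_mem (const Ω (-unitK) * x)⟩
  have hq : ofQuaternion Ω q = x + x := by
    rw [ofQuaternion_apply]
    simp only [q, PureQuaternion.ofComponents_re, PureQuaternion.ofComponents_imI,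
      PureQuaternion.ofComponents_imJ, PureQuaternion.ofComponents_imK]
    have h := congrArg (fun y => y - x.conj - x.conj) key
    calc _ = _ := by abel
      _ = _ := h
      _ = _ := by abel
  obtain ⟨r, hr⟩ := PureQuaternion.exists_add_self_eq two_ne_zero_semr q
  exact ⟨r, add_self_injective (by rw [← hq, ← hr, map_add])⟩

lemma realPart_ofQuaternion (q : ℍ[SEMR Ω]) : (ofQuaternion Ω q).realPart = q.re := by
  have h : q + star q = (q.re : ℍ[SEMR Ω]) + q.re := by ext <;> simp
  rw [realPart, conj_ofQuaternion, ← map_add, h, map_add, half_mul_add_self, ofQuaternion_coe]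

lemma vecPart_ofQuaternion (q : ℍ[SEMR Ω]) : (ofQuaternion Ω q).vecPart = ofQuaternion Ω q.im := by
  rw [vecPart, realPart_ofQuaternion, ← ofQuaternion_coe, ← map_sub]
  congr 1
  ext <;> simp

lemma symmetrized_ofQuaternion (q : ℍ[SEMR Ω]) :
    (ofQuaternion Ω q).symmetrized = ofQuaternion Ω (q * star q) := by
  rw [symmetrized, conj_ofQuaternion, map_mul]

/-! ### Transfer of the kernel computation to `SEM Ω` -/

/-- The kernel of a Sylvester operator of rank two, in terms of the ring structure only. -/
lemma sylvester_kernel {f g : SEM Ω} (hf : f ∉ SEMR Ω) (hg : g ∉ SEMR Ω)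
    (h0 : f.realPart = -g.realPart)
    (hv : f.vecPart.symmetrized = g.vecPart.symmetrized) :
    (∀ χ, f * χ + χ * g = 0 ↔ ∃ h, χ = f * h + h * g.conj) ∧
    ∃ u v : SEM Ω, IsUnit u ∧ IsUnit v ∧ f * u + u * g = 0 ∧ f * v + v * g = 0 ∧
      (∀ s t : SEMR Ω, s • u + t • v = 0 → s = 0 ∧ t = 0) ∧
      ∀ χ, f * χ + χ * g = 0 → ∃ s t : SEMR Ω, s • u + t • v = χ := by
  obtain ⟨p, rfl⟩ := ofQuaternion_surjective f
  obtain ⟨q, rfl⟩ := ofQuaternion_surjective g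
  have hre : p.re = -q.re := by
    rw [realPart_ofQuaternion, realPart_ofQuaternion] at h0
    exact Subtype.ext h0
  have ha : p.im.re = 0 := by simp
  have hb : q.im.re = 0 := by simp
  have hab : p.im * p.im = q.im * q.im := by
    rw [vecPart_ofQuaternion, vecPart_ofQuaternion, symmetrized_ofQuaternion,
      symmetrized_ofQuaternion] at hv
    exact PureQuaternion.im_mul_im_of_mul_star (ofQuaternion_injective hv)
  have him : ∀ x : ℍ[SEMR Ω], ofQuaternion Ω x ∉ SEMR Ω → x.im ≠ 0 := by
    intro x hx h
    have e : x = (x.re : ℍ[SEMR Ω]) := by rw [← Quaternion.re_add_im x, h]; simp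
    rw [e, ofQuaternion_coe] at hx
    exact hx x.re.2
  have ha0 := him p hf
  have hb0 := him q hg
  have h2 := two_ne_zero_semr (Ω := Ω)
  have hz : ∀ x, ofQuaternion Ω p * ofQuaternion Ω x + ofQuaternion Ω x * ofQuaternion Ω q = 0 ↔
      p.im * x + x * q.im = 0 := by
    intro x
    rw [← map_mul, ← map_mul, ← map_add, PureQuaternion.mul_add_mul_of_re hre,
      map_eq_zero_iff (ofQuaternion Ω) ofQuaternion_injective]
  refine ⟨fun χ => ?_, ?_⟩
  · obtain ⟨x, rfl⟩ := ofQuaternion_surjective χ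
    rw [hz, PureQuaternion.sylvester_eq_zero_iff h2 ha hb ha0 hab, conj_ofQuaternion,
      ofQuaternion_surjective.exists]
    refine exists_congr fun h => ?_
    rw [← map_mul, ← map_mul, ← map_add, PureQuaternion.mul_add_mul_star_of_re hre,
      ofQuaternion_injective.eq_iff]
  · obtain ⟨u, v, hu, hv, hu0, hv0, hli, hsp⟩ :=
      PureQuaternion.exists_units_spanning h2 ha hb ha0 hb0 hab
    refine ⟨ofQuaternion Ω u, ofQuaternion Ω v, hu.map _, hv.map _, (hz u).2 hu0, (hz v).2 hv0,
      fun s t h => hli s t ?_, fun χ hχ => ?_⟩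
    · rw [← map_eq_zero_iff (ofQuaternion Ω) ofQuaternion_injective, map_add, map_smul, map_smul]
      exact h
    · obtain ⟨x, rfl⟩ := ofQuaternion_surjective χ
      obtain ⟨s, t, rfl⟩ := hsp x ((hz x).1 hχ)
      exact ⟨s, t, by rw [map_add, map_smul, map_smul]⟩

end

end SEM

end SliceRegular

end

open SliceRegular
theorem mainTheorem2 (Ω : CircularDomain) (f g : SEM Ω)
    (hf : f ∉ SEMR Ω) (hg : g ∉ SEMR Ω)
    (h0 : f.realPart = -g.realPart)
    (hv : f.vecPart.symmetrized = g.vecPart.symmetrized) :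
    (LinearMap.ker (sylvester f g) : Set (SEM Ω)) = {χ | ∃ h : SEM Ω, χ = f * h + h * g.conj} ∧
    Module.finrank (SEMR Ω) (LinearMap.ker (sylvester f g)) = 2 ∧
    ∃ b : Module.Basis (Fin 2) (SEMR Ω) (LinearMap.ker (sylvester f g)),
      ∀ i, IsUnit (b i : SEM Ω) := by
  obtain ⟨hker, u, v, hu, hv, hu0, hv0, hli, hsp⟩ := SEM.sylvester_kernel hf hg h0 hv
  let w : Fin 2 → LinearMap.ker (sylvester f g) := ![⟨u, hu0⟩, ⟨v, hv0⟩]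
  have hw : LinearIndependent (SEMR Ω) w :=
    LinearIndependent.pair_iff.2 fun s t h => hli s t (congrArg Subtype.val h)
  have hspan : ⊤ ≤ Submodule.span (SEMR Ω) (Set.range w) := by
    rintro ⟨χ, hχ⟩ -
    obtain ⟨s, t, h⟩ := hsp χ hχ
    rw [Matrix.range_cons, Matrix.range_cons, Matrix.range_empty, Set.union_empty,
      Set.singleton_union, Submodule.mem_span_pair]
    exact ⟨s, t, Subtype.ext h⟩
  let b := Module.Basis.mk hw hspan
  -- Reading the rank off a basis needs this condition, which follows from the commutativity
  -- contained in the field structure.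
  have hsrc : StrongRankCondition (SEMR Ω) := by
    let := SEM.semrField Ω
    exact commRing_strongRankCondition (SEMR Ω)
  refine ⟨Set.ext hker, ?_, b, fun i => ?_⟩
  · rw [Module.finrank_eq_card_basis b, Fintype.card_fin]
  · rw [Module.Basis.mk_apply]
    fin_cases i
    · exact hu
    · exact hv
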